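/- For $N\ge 1$ let $\mathrm{U}(N)$ be the unitary group with its Haar probability measure $dU$, and for $A,B\in M_N(\mathbb{C})$ let $$I_N(z;A,B)=\int_{\mathrm{U}(N)}e^{-zN\operatorname{Tr}(AUBU^{-1})}\,dU,\qquad z\in\mathbb{C}.$$ If $D\subseteq\mathbb{C}$ is a simply connected domain containing $0$ on which $I_N(\cdot;A,B)$ has no zeros, let $F_N(\cdot;A,B)$ be the unique holomorphic function on $D$ with $I_N=e^{N^2F_N}$ and $F_N(0;A,B)=0$. Let $M\ge 0$. A sequence $A_N\in M_N(\mathbb{C})$, $N\ge1$, of normal matrices is called $(M,0)$-regular with limit moments $\Phi=(\phi_k)_{k\ge1}$ if $\|A_N\|\le M$ (operator norm) for all $N\geq 1$ and $N^{-1}\operatorname{Tr}(A_N^k)\to\phi_k$ as $N\to\infty$ for every $k\ge1$. For $d\ge1$ and partitions $\alpha,\beta\vdash d$ with $\ell(\alpha),\ell(\beta)$ parts, let $\vec H_0(\alpha,\beta)$ be the genus-zero monotone double Hurwitz number, i.e. the number of tuples $(\rho,\sigma,\tau_1,\dots,\tau_r)$ of permutations in $S(d)$ such that: $\rho$ has cycle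 type $\alpha$, $\sigma$ has cycle type $\beta$, and the $\tau_i$ are transpositions; $\rho\sigma\tau_1\cdots\tau_r=\mathrm{id}$; $\langle\rho,\sigma,\tau_1,\dots,\tau_r\rangle$ is transitive on $\{1,\dots,d\}$; $r=\ell(\alpha)+\ell(\beta)-2$; and, writing $\tau_i=(s_i\ t_i)$ with $s_i<t_i$, one has $t_1\le\dots\le t_r$. Put $$C_0(z;\Phi,\Psi)=\sum_{d=1}^\infty\frac{z^d}{d!}\sum_{\alpha,\beta\vdash d}(-1)^{d+\ell(\alpha)+\ell(\beta)}\vec H_0(\alpha,\beta)\,\phi_\alpha\psi_\beta,\qquad \phi_\alpha=\prod_i\phi_{\alpha_i},\quad \psi_\beta=\prod_j\psi_{\beta_j}.$$ **Theorem.** Let $A_N,B_N$ be $(M,0)$-regular sequences of normal matrices with limit moments $\Phi$ and $\Psi$, and assume that $$0\notin\overline{\bigcup_{N\ge1}\{z\in\mathbb{C}: I_N(z;A_N,B_N)=0\}}.$$ Then there is a simply connected domain $D$ with $0\in D\subseteq\{z:|z|<\tfrac{2}{27}M^{-2}\}$ (all of $\mathbb{C}$ if $M=0$) such that, for all $N\geq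 1$, $I_N(\cdot;A_N,B_N)$ has no zeros in $D$, so that $F_N(\cdot;A_N,B_N)$ is defined and holomorphic on $D$; the series $C_0(z;\Phi,\Psi)$ converges absolutely for every $z\in D$; and $F_N(z;A_N,B_N)\to C_0(z;\Phi,\Psi)$ as $N\to\infty$, uniformly on compact subsets of $D$. -/

import Mathlib

open Filter Topology MeasureTheory

noncomputable section

namespace HCIZ

/-! ### Haar probability measure on the unitary group -/

instance unitaryGroup_compactSpace (N : ℕ) :
    CompactSpace (Matrix.unitaryGroup (Fin N) ℂ) := by
  have hpi : IsCompact (Set.univ.pi fun _ : Fin N => Set.univ.pi fun _ : Fin N =>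
      Metric.closedBall (0 : ℂ) 1) :=
    isCompact_univ_pi fun _ => isCompact_univ_pi fun _ => isCompact_closedBall _ _
  have hcl : IsClosed ((Matrix.unitaryGroup (Fin N) ℂ : Set (Matrix (Fin N) (Fin N) ℂ))) :=
    isClosed_unitary
  refine isCompact_iff_compactSpace.mp (IsCompact.of_isClosed_subset hpi hcl ?_)
  intro U hU
  exact fun i _ j _ => mem_closedBall_zero_iff.mpr (entry_norm_bound_of_unitary hU i j)

instance unitaryGroup_measurableSpace (N : ℕ) :
    MeasurableSpace (Matrix.unitaryGroup (Fin N) ℂ) :=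
  borel _

instance unitaryGroup_borelSpace (N : ℕ) :
    BorelSpace (Matrix.unitaryGroup (Fin N) ℂ) :=
  ⟨rfl⟩

/-- The Haar measure of the unitary group `U(N)`, normalized to have total mass `1`. -/
def unitaryHaar (N : ℕ) : Measure (Matrix.unitaryGroup (Fin N) ℂ) :=
  Measure.haarMeasure ⊤

/-! ### The HCIZ integral and its free energy -/

/-- The HCIZ integral `I_N(z; A, B) = ∫_{U(N)} exp (-z N Tr(A U B U⁻¹)) dU`. -/
def hcizIntegral {N : ℕ} (A B : Matrix (Fin N) (Fin N) ℂ) (z : ℂ) : ℂ :=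
  ∫ U : Matrix.unitaryGroup (Fin N) ℂ,
    Complex.exp (-z * (N : ℂ) *
      Matrix.trace (A * (U : Matrix (Fin N) (Fin N) ℂ) * B *
        ((U⁻¹ : Matrix.unitaryGroup (Fin N) ℂ) : Matrix (Fin N) (Fin N) ℂ)))
    ∂(unitaryHaar N)

/-- `F` is the free energy `F_N(·; A, B)` on the domain `D`: the holomorphic solution of
`I_N(z; A, B) = exp (N² F(z))` on `D` with `F(0) = 0`. For `N ≥ 1` and `D` open, connected and
containing `0`, the values of such an `F` on `D` are uniquely determined. -/
structure IsFreeEnergyOn {N : ℕ} (A B : Matrix (Fin N) (Fin N) ℂ) (D : Set ℂ) (F : ℂ → ℂ) :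
    Prop where
  differentiableOn : DifferentiableOn ℂ F D
  map_zero : F 0 = 0
  exp_eq : ∀ z ∈ D, hcizIntegral A B z = Complex.exp ((N : ℂ) ^ 2 * F z)

/-- The HCIZ non-vanishing hypothesis: `0` is not in the closure of the union over `N ≥ 1` of the
zero sets of `I_N(·; A_N, B_N)`. -/
def NonVanishing (A B : (N : ℕ) → Matrix (Fin N) (Fin N) ℂ) : Prop :=
  (0 : ℂ) ∉ closure (⋃ N ≥ 1, {z : ℂ | hcizIntegral (A N) (B N) z = 0})

/-! ### Regular sequences of normal matrices -/

/-- `A_N`, `N ≥ 1`, is an `(M, h)`-regular sequence of normal matrices with limit moments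
`φ_k`, `k ≥ 1`. The norm is the operator norm on `ℂ^N` with its Hermitian inner product; the
values `A 0` and `φ 0` play no role. -/
structure IsRegular (M : ℝ) (h : ℕ) (A : (N : ℕ) → Matrix (Fin N) (Fin N) ℂ) (φ : ℕ → ℂ) :
    Prop where
  normal : ∀ N ≥ 1, IsStarNormal (A N)
  norm_le : ∀ N ≥ 1, ‖Matrix.toEuclideanCLM (n := Fin N) (𝕜 := ℂ) (A N)‖ ≤ M
  moments : ∀ k ≥ 1,
    (fun N : ℕ => (N : ℂ)⁻¹ * Matrix.trace (A N ^ k) - φ k)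
      =o[atTop] fun N : ℕ => ((N : ℝ) ^ (2 * h))⁻¹

/-! ### Monotone double Hurwitz numbers -/

/-- The number of tuples `(ρ, σ, τ₁, …, τ_r)` of permutations in `S(d)` such that `ρ` has cycle
type `α`, `σ` has cycle type `β`, the product `ρ σ τ₁ ⋯ τ_r` is the identity, the group generated
by all these permutations is transitive, and `τ_i = (s_i t_i)` with `s_i < t_i` and
`t₁ ≤ ⋯ ≤ t_r`. -/
def monotoneCount {d : ℕ} (r : ℕ) (α β : Nat.Partition d) : ℕ :=
  Nat.card {x : Equiv.Perm (Fin d) × Equiv.Perm (Fin d) × (Fin r → Equiv.Perm (Fin d)) //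
    x.1.partition.parts = α.parts ∧
    x.2.1.partition.parts = β.parts ∧
    x.1 * x.2.1 * (List.ofFn x.2.2).prod = 1 ∧
    MulAction.IsPretransitive
      (Subgroup.closure ({x.1, x.2.1} ∪ Set.range x.2.2)) (Fin d) ∧
    ∃ s t : Fin r → Fin d,
      (∀ i, s i < t i ∧ x.2.2 i = Equiv.swap (s i) (t i)) ∧ Monotone t}

/-- The length (number of parts) of a partition. -/
def len {d : ℕ} (α : Nat.Partition d) : ℕ := Multiset.card α.parts

/-- The genus `g` monotone double Hurwitz number of `α, β ⊢ d`, `d ≥ 1`; the number of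
transpositions is `r = 2g - 2 + ℓ(α) + ℓ(β)`, which is nonnegative since `ℓ(α), ℓ(β) ≥ 1`. -/
def monotoneHurwitz {d : ℕ} (g : ℕ) (α β : Nat.Partition d) : ℕ :=
  monotoneCount (2 * g + len α + len β - 2) α β

/-- `φ_α = ∏ i, φ_{α_i}`. -/
def partProd {d : ℕ} (φ : ℕ → ℂ) (α : Nat.Partition d) : ℂ :=
  (α.parts.map φ).prod

/-- `C_{g,d}(Φ, Ψ) = ∑_{α, β ⊢ d} (-1)^{d + ℓ(α) + ℓ(β)} H_g(α, β) φ_α ψ_β`. -/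
def coeffC (g d : ℕ) (φ ψ : ℕ → ℂ) : ℂ :=
  ∑ α : Nat.Partition d, ∑ β : Nat.Partition d,
    (-1 : ℂ) ^ (d + len α + len β) * (monotoneHurwitz g α β : ℂ) * partProd φ α * partProd ψ β

/-- The term of index `d = n + 1` of the generating series `C_g(z; Φ, Ψ)`. -/
def termC (g : ℕ) (φ ψ : ℕ → ℂ) (z : ℂ) (n : ℕ) : ℂ :=
  coeffC g (n + 1) φ ψ * z ^ (n + 1) / ((n + 1).factorial : ℂ)

/-- `C_g(z; Φ, Ψ) = ∑_{d ≥ 1} C_{g,d}(Φ, Ψ) z^d / d!`. -/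
def genC (g : ℕ) (φ ψ : ℕ → ℂ) (z : ℂ) : ℂ := ∑' n : ℕ, termC g φ ψ z n

end HCIZ

end

/-! The derivatives of the HCIZ integral at 0 are moments of Tr(AUBU⁻¹), and unitary moments have an
explicit expansion in 1/N. Left invariance of Haar measure gives a loop equation relating moments of
degree d + 1 to those of degree d (`unitaryMoment_recursion`). Its left side is N + J, where J sums
the transpositions (s, last), a Jucys–Murphy element. Inverting it by a Neumann series and iterating
on the degree writes the moments as a sum over monotone walks, each step contributing -1/N
(`unitaryMoment_eq_tsum`). Contracting with A and B, for d < N the d-th derivative at 0 is (-1)^d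
times a sum over factorizations ρ σ τ₁ ⋯ τ_r = 1, weighted by traces over the cycles of ρ and σ and
by (-1/N)^r (`iteratedDeriv_hcizIntegral_zero`).

Taking the logarithm keeps the transitive factorizations: splitting off the orbit of one point
(`partitionFn_succ`) is the recursion that f' = G' f imposes on the derivatives of f = exp G
(`iteratedDeriv_log_hcizIntegral`). The weight of a factorization is a normalized weight times
N^(ℓ(α) + ℓ(β) - r). For a transitive one the exponent is at most 2, by Scott's lemma applied to
permutation representations (`card_parts_add_card_parts_le`). After division by N² only equality,
i.e. genus zero, survives as N → ∞; dominated convergence then makes each Taylor coefficient of F_N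
converge to that of C₀ (`tendsto_connectedFn`).

Coefficientwise convergence becomes uniform convergence through a bound independent of N.
Non-vanishing supplies a common zero-free disc, on which logarithms exist. The estimate |I_N(z)| ≤
exp(N² M² |z|) bounds Re F_N there, Borel–Carathéodory bounds |F_N| on a smaller disc, and Cauchy's
estimates dominate the Taylor series (`tendstoUniformlyOn_of_tendsto_iteratedDeriv`). The domain D
is thus a small disc, and summability of C₀ on it comes from these bounds rather than from growth
estimates for Hurwitz numbers. -/

noncomputable section
namespace HCIZ

open Equiv

/-! ### Monotone walks, factorizations, and their splitting along invariant sets. -/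

section Walks

set_option linter.unusedSectionVars false

variable {α β γ : Type} [Fintype α] [LinearOrder α] [Fintype β] [LinearOrder β]
  [Fintype γ] [LinearOrder γ]

/-- A family of lists encodes a sequence of transpositions `(s t)`, grouped by `t`; it is valid
if `s < t` throughout. -/
def ValidWalk (L : α → List α) : Prop := ∀ t, ∀ s ∈ L t, s < t

/-- The number of transpositions in a walk. -/
def walkLength (L : α → List α) : ℕ := ∑ t, (L t).length

/-- The product of the transpositions `(s t)`, for `s` in the list `l`. -/
def stepPerm (t : α) (l : List α) : Perm α := (l.map fun s => swap s t).prod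

/-- The product of all transpositions of a walk, ordered by increasing `t`. -/
def walkPerm (L : α → List α) : Perm α :=
  ((Finset.univ.sort (· ≤ ·)).map fun t => stepPerm t (L t)).prod

/-- The data of a factorization: two permutations and a monotone walk. -/
abbrev Datum (α : Type) : Type := Perm α × Perm α × (α → List α)

/-- The datum is a monotone factorization of the identity. -/
def IsConfig (T : Datum α) : Prop := ValidWalk T.2.2 ∧ T.1 * T.2.1 * walkPerm T.2.2 = 1

/-- The set `S` is invariant under all permutations of the datum. -/
def Inv (T : Datum α) (S : Set α) : Prop :=
  (∀ a, T.1 a ∈ S ↔ a ∈ S) ∧ (∀ a, T.2.1 a ∈ S ↔ a ∈ S) ∧ ∀ t, ∀ s ∈ T.2.2 t, (s ∈ S ↔ t ∈ S)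

/-- The permutations of the datum generate a transitive group. -/
def Trans (T : Datum α) : Prop := ∀ S, Inv T S → S.Nonempty → S = Set.univ

theorem Inv.compl {T : Datum α} {S : Set α} (h : Inv T S) : Inv T Sᶜ :=
  ⟨fun a => not_congr (h.1 a), fun a => not_congr (h.2.1 a),
    fun t s hs => not_congr (h.2.2 t s hs)⟩

/-- Complements of invariant sets are invariant, so testing the sets through one base point
suffices. -/
theorem trans_iff (T : Datum α) (x : α) : Trans T ↔ ∀ S, Inv T S → x ∈ S → S = Set.univ := by
  refine ⟨fun h S hS hx => h S hS ⟨x, hx⟩, fun h S hS hne => ?_⟩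
  by_cases hx : x ∈ S
  · exact h S hS hx
  · have := h _ hS.compl hx
    rw [Set.compl_univ_iff] at this
    simp [this] at hne

/-- The smallest invariant set containing `x`. -/
def orbitOf (T : Datum α) (x : α) : Set α := ⋂₀ {S | Inv T S ∧ x ∈ S}

theorem inv_orbitOf (T : Datum α) (x : α) : Inv T (orbitOf T x) := by
  simp only [Inv, orbitOf, Set.mem_sInter, Set.mem_ofPred_eq]
  exact ⟨fun a => forall₂_congr fun S hS => hS.1.1 a, fun a => forall₂_congr fun S hS => hS.1.2.1 a,
    fun t s hs => forall₂_congr fun S hS => hS.1.2.2 t s hs⟩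

theorem mem_orbitOf (T : Datum α) (x : α) : x ∈ orbitOf T x := fun _ hS => hS.2

theorem orbitOf_subset {T : Datum α} {x : α} {S : Set α} (h : Inv T S) (hx : x ∈ S) :
    orbitOf T x ⊆ S := fun _ ha => ha S ⟨h, hx⟩

/-! ### Merging data along a decomposition of the index set -/

/-- The permutation of `α` acting by a pair of permutations on the two parts. -/
def mergePerm (e : β ⊕ γ ≃ α) : Perm β × Perm γ →* Perm α :=
  e.permCongrHom.toMonoidHom.comp (Perm.sumCongrHom β γ)

@[simp] theorem mergePerm_inl (e : β ⊕ γ ≃ α) (p : Perm β × Perm γ) (b : β) :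
    mergePerm e p (e (Sum.inl b)) = e (Sum.inl (p.1 b)) := by
  simp [mergePerm, permCongrHom]

@[simp] theorem mergePerm_inr (e : β ⊕ γ ≃ α) (p : Perm β × Perm γ) (c : γ) :
    mergePerm e p (e (Sum.inr c)) = e (Sum.inr (p.2 c)) := by
  simp [mergePerm, permCongrHom]

theorem mergePerm_injective (e : β ⊕ γ ≃ α) : Function.Injective (mergePerm e) := by
  intro p q h
  refine Prod.ext (Equiv.ext fun b => ?_) (Equiv.ext fun c => ?_)
  · have := congrArg (fun f => f (e (Sum.inl b))) h
    simpa using this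
  · have := congrArg (fun f => f (e (Sum.inr c))) h
    simpa using this

/-- The walk on `α` given by walks on the two parts. -/
def mergeWalk (e : β ⊕ γ ≃ α) (L₁ : β → List β) (L₂ : γ → List γ) (t : α) : List α :=
  Sum.elim (fun b => (L₁ b).map fun x => e (Sum.inl x))
    (fun c => (L₂ c).map fun x => e (Sum.inr x)) (e.symm t)

@[simp] theorem mergeWalk_inl (e : β ⊕ γ ≃ α) (L₁ : β → List β) (L₂ : γ → List γ) (b : β) :
    mergeWalk e L₁ L₂ (e (Sum.inl b)) = (L₁ b).map fun x => e (Sum.inl x) := by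
  simp [mergeWalk]

@[simp] theorem mergeWalk_inr (e : β ⊕ γ ≃ α) (L₁ : β → List β) (L₂ : γ → List γ) (c : γ) :
    mergeWalk e L₁ L₂ (e (Sum.inr c)) = (L₂ c).map fun x => e (Sum.inr x) := by
  simp [mergeWalk]

/-- The datum on `α` given by data on the two parts. -/
def mergeDatum (e : β ⊕ γ ≃ α) (p : Datum β × Datum γ) : Datum α :=
  (mergePerm e (p.1.1, p.2.1), mergePerm e (p.1.2.1, p.2.2.1), mergeWalk e p.1.2.2 p.2.2.2)

theorem mergeDatum_injective (e : β ⊕ γ ≃ α) : Function.Injective (mergeDatum e) := by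
  rintro ⟨⟨a, b, c⟩, a', b', c'⟩ ⟨⟨x, y, z⟩, x', y', z'⟩ h
  simp only [mergeDatum, Prod.mk.injEq] at h
  obtain ⟨h1, h2, h3⟩ := h
  have h1 := mergePerm_injective e h1
  have h2 := mergePerm_injective e h2
  simp only [Prod.mk.injEq] at h1 h2
  have h4 : c = z := by
    funext b
    have := congrFun h3 (e (Sum.inl b))
    simp only [mergeWalk_inl] at this
    exact List.map_injective_iff.mpr (fun x y h => by simpa using h) this
  have h5 : c' = z' := by
    funext b
    have := congrFun h3 (e (Sum.inr b))
    simp only [mergeWalk_inr] at this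
    exact List.map_injective_iff.mpr (fun x y h => by simpa using h) this
  simp [h1, h2, h4, h5]

theorem forall_sum_equiv (e : β ⊕ γ ≃ α) {P : α → Prop} :
    (∀ a, P a) ↔ (∀ b, P (e (Sum.inl b))) ∧ ∀ c, P (e (Sum.inr c)) := by
  rw [← Sum.forall (p := fun x => P (e x)), e.forall_congr_left]
  simp

theorem walkLength_merge (e : β ⊕ γ ≃ α) (L₁ : β → List β) (L₂ : γ → List γ) :
    walkLength (mergeWalk e L₁ L₂) = walkLength L₁ + walkLength L₂ := by
  simp [walkLength, ← e.sum_comp]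

theorem stepPerm_merge_inl (e : β ⊕ γ ≃ α) (t : β) (l : List β) :
    stepPerm (e (Sum.inl t)) (l.map fun x => e (Sum.inl x)) = mergePerm e (stepPerm t l, 1) := by
  have key : ∀ s t : β, swap (e (Sum.inl s)) (e (Sum.inl t)) = mergePerm e (swap s t, 1) := by
    intro s t
    ext a
    obtain ⟨x | x, rfl⟩ := e.surjective a
    · rw [mergePerm_inl]; simp only [swap_apply_def, e.apply_eq_iff_eq, Sum.inl.injEq]
      split_ifs <;> rfl
    · rw [mergePerm_inr]; simp [swap_apply_def]
  induction l with
  | nil => exact (map_one (mergePerm e)).symm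
  | cons s l ih =>
    have : (stepPerm t (s :: l), (1 : Perm γ)) = (swap s t, 1) * (stepPerm t l, 1) := by
      simp [stepPerm]
    rw [this, map_mul, ← ih, ← key]
    simp [stepPerm]

theorem stepPerm_merge_inr (e : β ⊕ γ ≃ α) (t : γ) (l : List γ) :
    stepPerm (e (Sum.inr t)) (l.map fun x => e (Sum.inr x)) = mergePerm e (1, stepPerm t l) := by
  have key : ∀ s t : γ, swap (e (Sum.inr s)) (e (Sum.inr t)) = mergePerm e (1, swap s t) := by
    intro s t
    ext a
    obtain ⟨x | x, rfl⟩ := e.surjective a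
    · rw [mergePerm_inl]; simp [swap_apply_def]
    · rw [mergePerm_inr]; simp only [swap_apply_def, e.apply_eq_iff_eq, Sum.inr.injEq]
      split_ifs <;> rfl
  induction l with
  | nil => exact (map_one (mergePerm e)).symm
  | cons s l ih =>
    have : ((1 : Perm β), stepPerm t (s :: l)) = (1, swap s t) * (1, stepPerm t l) := by
      simp [stepPerm]
    rw [this, map_mul, ← ih, ← key]
    simp [stepPerm]

theorem sort_univ_eq {l : List α} (h : l.Pairwise (· < ·)) (hm : ∀ a, a ∈ l) :
    Finset.univ.sort (· ≤ ·) = l := by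
  have h1 : l.toFinset = Finset.univ := by ext a; simp [hm]
  rw [← h1, List.toFinset_sort _ (h.imp ne_of_lt)]
  exact h.imp le_of_lt

/-- The order of `α` may interleave the two parts, but `mergePerm e` is a homomorphism from a direct
product, so steps of different parts commute and the product separates. Strict monotonicity ensures
that each part is still traversed in its own increasing order. -/
theorem walkPerm_merge (e : β ⊕ γ ≃ α) (hl : StrictMono fun b => e (Sum.inl b))
    (hr : StrictMono fun c => e (Sum.inr c)) (L₁ : β → List β) (L₂ : γ → List γ) :
    walkPerm (mergeWalk e L₁ L₂) = mergePerm e (walkPerm L₁, walkPerm L₂) := by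
  have key : ∀ l : List (β ⊕ γ),
      ((l.map e).map fun t => stepPerm t (mergeWalk e L₁ L₂ t)).prod =
        mergePerm e (((l.filterMap Sum.getLeft?).map fun t => stepPerm t (L₁ t)).prod,
          ((l.filterMap Sum.getRight?).map fun t => stepPerm t (L₂ t)).prod) := by
    intro l
    induction l with
    | nil => exact (map_one (mergePerm e)).symm
    | cons x l ih =>
      obtain x | x := x
      · simp only [List.map_cons, List.prod_cons, ih, mergeWalk_inl, stepPerm_merge_inl, ← map_mul]
        rw [List.filterMap_cons_none (f := Sum.getRight?) (by rfl)]
        simp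
      · simp only [List.map_cons, List.prod_cons, ih, mergeWalk_inr, stepPerm_merge_inr, ← map_mul]
        rw [List.filterMap_cons_none (f := Sum.getLeft?) (by rfl)]
        simp
  have hs : (Finset.univ.sort (α := α) (· ≤ ·)).Pairwise (· < ·) := Finset.sortedLT_sort _ |>.pairwise
  have h0 : ((Finset.univ.sort (α := α) (· ≤ ·)).map e.symm).map e = Finset.univ.sort (· ≤ ·) := by
    simp
  have hs' : ((Finset.univ.sort (α := α) (· ≤ ·)).map e.symm).Pairwise (fun x y => e x < e y) := by
    rw [List.pairwise_map]; simpa using hs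
  unfold walkPerm
  rw [← h0, key]
  congr 4
  · refine (sort_univ_eq ?_ ?_).symm
    · rw [List.pairwise_filterMap]
      refine hs'.imp ?_
      rintro (x | x) (y | y) h <;> simp
      exact hl.lt_iff_lt.mp h
    · intro b; simp only [List.mem_filterMap, List.mem_map]
      exact ⟨Sum.inl b, ⟨e (Sum.inl b), by simp⟩, rfl⟩
  · refine (sort_univ_eq ?_ ?_).symm
    · rw [List.pairwise_filterMap]
      refine hs'.imp ?_
      rintro (x | x) (y | y) h <;> simp
      exact hr.lt_iff_lt.mp h
    · intro b; simp only [List.mem_filterMap, List.mem_map]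
      exact ⟨Sum.inr b, ⟨e (Sum.inr b), by simp⟩, rfl⟩

theorem isConfig_merge (e : β ⊕ γ ≃ α) (hl : StrictMono fun b => e (Sum.inl b))
    (hr : StrictMono fun c => e (Sum.inr c)) (p : Datum β × Datum γ) :
    IsConfig (mergeDatum e p) ↔ IsConfig p.1 ∧ IsConfig p.2 := by
  have h1 : mergePerm e (p.1.1, p.2.1) * mergePerm e (p.1.2.1, p.2.2.1) *
      walkPerm (mergeWalk e p.1.2.2 p.2.2.2) = 1 ↔
      p.1.1 * p.1.2.1 * walkPerm p.1.2.2 = 1 ∧ p.2.1 * p.2.2.1 * walkPerm p.2.2.2 = 1 := by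
    rw [walkPerm_merge e hl hr, ← map_mul, ← map_mul, ← map_one (mergePerm e),
      (mergePerm_injective e).eq_iff]
    simp [Prod.ext_iff]
  have h2 : ValidWalk (mergeWalk e p.1.2.2 p.2.2.2) ↔ ValidWalk p.1.2.2 ∧ ValidWalk p.2.2.2 := by
    unfold ValidWalk
    rw [forall_sum_equiv e]
    simp only [mergeWalk_inl, mergeWalk_inr, List.forall_mem_map]
    simp only [hl.lt_iff_lt, hr.lt_iff_lt]
  unfold IsConfig mergeDatum
  rw [h1, h2]
  tauto

theorem inv_merge (e : β ⊕ γ ≃ α) (p : Datum β × Datum γ) (S : Set α) :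
    Inv (mergeDatum e p) S ↔ Inv p.1 {b | e (Sum.inl b) ∈ S} ∧ Inv p.2 {c | e (Sum.inr c) ∈ S} := by
  have h : (∀ t, ∀ s ∈ mergeWalk e p.1.2.2 p.2.2.2 t, (s ∈ S ↔ t ∈ S)) ↔
      (∀ t, ∀ s ∈ p.1.2.2 t, (e (Sum.inl s) ∈ S ↔ e (Sum.inl t) ∈ S)) ∧
      ∀ t, ∀ s ∈ p.2.2.2 t, (e (Sum.inr s) ∈ S ↔ e (Sum.inr t) ∈ S) := by
    rw [forall_sum_equiv e]
    simp only [mergeWalk_inl, mergeWalk_inr, List.forall_mem_map]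
  unfold Inv mergeDatum
  rw [h]
  simp only [forall_sum_equiv e, mergePerm_inl, mergePerm_inr, Set.mem_ofPred_eq]
  tauto

/-- Translates "the orbit of a point is exactly this set" into transitivity of the restricted datum;
this is what makes connected factors appear in the exponential formula. -/
theorem orbitOf_merge_iff (e : β ⊕ γ ≃ α) (p : Datum β × Datum γ) (x : β) :
    orbitOf (mergeDatum e p) (e (Sum.inl x)) = Set.range (fun b => e (Sum.inl b)) ↔
      Trans p.1 := by
  rw [trans_iff p.1 x]
  constructor
  · intro h S hS hx
    have h1 : Inv (mergeDatum e p) ((fun b => e (Sum.inl b)) '' S) := by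
      rw [inv_merge]
      simpa [Inv] using hS
    have h2 := orbitOf_subset h1 (x := e (Sum.inl x)) ⟨x, hx, rfl⟩
    rw [h] at h2
    refine Set.eq_univ_of_forall fun b => ?_
    obtain ⟨b', hb, hbb⟩ := h2 ⟨b, rfl⟩
    simp only [EmbeddingLike.apply_eq_iff_eq, Sum.inl.injEq] at hbb
    exact hbb ▸ hb
  · intro h
    apply subset_antisymm
    · refine orbitOf_subset ?_ ⟨x, rfl⟩
      rw [inv_merge]
      simp [Inv]
    · have h1 := ((inv_merge e p _).mp (inv_orbitOf (mergeDatum e p) (e (Sum.inl x)))).1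
      have h2 := h _ h1 (mem_orbitOf (mergeDatum e p) (e (Sum.inl x)))
      rintro _ ⟨b, rfl⟩
      exact (Set.ext_iff.mp h2 b).mpr trivial

theorem exists_mergePerm (e : β ⊕ γ ≃ α) (π : Perm α)
    (h : ∀ a, π a ∈ Set.range (fun b => e (Sum.inl b)) ↔ a ∈ Set.range (fun b => e (Sum.inl b))) :
    ∃ p, mergePerm e p = π := by
  have h1 : Set.MapsTo (e.permCongr.symm π) (Set.range (Sum.inl : β → β ⊕ γ))
      (Set.range Sum.inl) := by
    rintro _ ⟨b, rfl⟩
    obtain ⟨b', hb⟩ := (h (e (Sum.inl b))).mpr ⟨b, rfl⟩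
    exact ⟨b', by simp [← hb]⟩
  obtain ⟨p, hp⟩ := Perm.mem_sumCongrHom_range_of_perm_mapsTo_inl h1
  exact ⟨p, by simp [mergePerm, hp, permCongrHom, -permCongr_symm]⟩

theorem exists_mergeDatum (e : β ⊕ γ ≃ α) (T : Datum α)
    (h : Inv T (Set.range fun b => e (Sum.inl b))) : T ∈ Set.range (mergeDatum e) := by
  obtain ⟨ρ, σ, L⟩ := T
  obtain ⟨p, hp⟩ := exists_mergePerm e ρ h.1
  obtain ⟨q, hq⟩ := exists_mergePerm e σ h.2.1
  have h3 := h.2.2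
  rw [forall_sum_equiv e] at h3
  have h1 : ∀ b, ∃ l : List β, L (e (Sum.inl b)) = l.map fun x => e (Sum.inl x) := by
    intro b
    have : ∀ s ∈ L (e (Sum.inl b)), s ∈ Set.range fun x => e (Sum.inl x) := by
      intro s hs
      simpa using h3.1 b s hs
    obtain ⟨l, hl⟩ := (Set.range_list_map fun x : β => e (Sum.inl x)).ge this
    exact ⟨l, hl.symm⟩
  have h2 : ∀ b, ∃ l : List γ, L (e (Sum.inr b)) = l.map fun x => e (Sum.inr x) := by
    intro b
    have : ∀ s ∈ L (e (Sum.inr b)), s ∈ Set.range fun x => e (Sum.inr x) := by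
      intro s hs
      have := h3.2 b s hs
      obtain ⟨y | y, rfl⟩ := e.surjective s
      · simp at this
      · exact ⟨y, rfl⟩
    obtain ⟨l, hl⟩ := (Set.range_list_map fun x : γ => e (Sum.inr x)).ge this
    exact ⟨l, hl.symm⟩
  choose L₁ hL₁ using h1
  choose L₂ hL₂ using h2
  refine ⟨((p.1, q.1, L₁), (p.2, q.2, L₂)), ?_⟩
  simp only [mergeDatum, Prod.mk.eta, hp, hq, Prod.mk.injEq, true_and]
  funext t
  revert t
  rw [forall_sum_equiv e]
  simp [hL₁, hL₂]

end Walks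
-- Weighted sums over factorizations and the exponential formula.
section ConfigSum

set_option linter.unusedSectionVars false

/-- The trace of the operator `ρ ∘ A^{⊗ α}` on `(ℂ^N)^{⊗ α}`. -/
def cycTrace {α : Type} [Fintype α] [DecidableEq α] {N : ℕ} (A : Matrix (Fin N) (Fin N) ℂ)
    (ρ : Perm α) : ℂ :=
  ∑ i : α → Fin N, ∏ k, A (i (ρ k)) (i k)

variable {α β γ : Type} [Fintype α] [LinearOrder α] [Fintype β] [LinearOrder β]
  [Fintype γ] [LinearOrder γ] {N : ℕ} (A B : Matrix (Fin N) (Fin N) ℂ) (y : ℂ)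

theorem cycTrace_merge (e : β ⊕ γ ≃ α) (p : Perm β × Perm γ) :
    cycTrace A (mergePerm e p) = cycTrace A p.1 * cycTrace A p.2 := by
  unfold cycTrace
  rw [Finset.sum_mul_sum, ← Fintype.sum_prod_type',
    ← ((Equiv.sumArrowEquivProdArrow β γ (Fin N)).symm.trans
      (e.arrowCongr (Equiv.refl _))).sum_comp]
  refine Finset.sum_congr rfl fun i _ => ?_
  rw [← e.prod_comp, Fintype.prod_sum_type]
  simp [Equiv.arrowCongr]
  rfl

/-- The weight of a datum. -/
def weight (T : Datum α) : ℂ := cycTrace A T.1 * cycTrace B T.2.1 * y ^ walkLength T.2.2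

theorem weight_merge (e : β ⊕ γ ≃ α) (p : Datum β × Datum γ) :
    weight A B y (mergeDatum e p) = weight A B y p.1 * weight A B y p.2 := by
  simp only [weight, mergeDatum, cycTrace_merge, walkLength_merge, pow_add]
  ring

/-- Grouping words by length gives the geometric series of ratio `Fintype.card α * c`. -/
theorem summable_pow_length (c : ℝ) (hc : 0 ≤ c) (h : Fintype.card α * c < 1) :
    Summable fun l : List α => c ^ l.length := by
  rw [← (Equiv.sigmaFiberEquiv (List.length (α := α))).summable_iff]
  have h1 : ∀ n, Finite {l : List α // l.length = n} := fun n =>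
    (inferInstance : Finite (List.Vector α n))
  rw [summable_sigma_of_nonneg (fun x => by simp only [Function.comp]; positivity)]
  refine ⟨fun n => Summable.of_finite, ?_⟩
  refine (summable_geometric_of_lt_one (by positivity) h).congr fun n => ?_
  have h2 : ∀ x : {l : List α // l.length = n},
      ((fun l : List α => c ^ l.length) ∘ (Equiv.sigmaFiberEquiv List.length)) ⟨n, x⟩ = c ^ n := by
    rintro ⟨l, hl⟩
    simp [hl]
  simp_rw [h2]
  have : Fintype {l : List α // l.length = n} := Fintype.ofFinite _
  have hcard : Fintype.card {l : List α // l.length = n} = Fintype.card α ^ n := by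
    rw [← card_vector (α := α) n]; exact Fintype.card_congr (Equiv.refl _)
  rw [tsum_fintype, Finset.sum_const, Finset.card_univ, hcard, nsmul_eq_mul, mul_pow]
  push_cast
  ring

theorem summable_prod_of_nonneg {κ : Type} (f : κ → ℝ) (hf : Summable f) (h0 : 0 ≤ f) (n : ℕ) :
    Summable fun L : Fin n → κ => ∏ t, f (L t) := by
  induction n with
  | zero => exact Summable.of_finite
  | succ n ih =>
    rw [← (Fin.consEquiv fun _ => κ).summable_iff]
    refine (hf.mul_of_nonneg ih h0 fun L => Finset.prod_nonneg fun t _ => h0 _).congr fun p => ?_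
    simp [Fin.consEquiv, Fin.prod_univ_succ]

theorem summable_pow_walkLength (c : ℝ) (hc : 0 ≤ c) (h : Fintype.card α * c < 1) :
    Summable fun L : α → List α => c ^ walkLength L := by
  have h1 := summable_prod_of_nonneg _ (summable_pow_length c hc h)
    (fun l => by simp only [Pi.zero_apply]; positivity) (Fintype.card α)
  rw [← ((Fintype.equivFin α).arrowCongr (Equiv.refl (List α))).summable_iff] at h1
  refine h1.congr fun L => ?_
  simp only [Function.comp, walkLength, Finset.prod_pow_eq_pow_sum]
  congr 1
  rw [← (Fintype.equivFin α).sum_comp]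
  simp [Equiv.arrowCongr]

theorem summable_norm_weight (h : Fintype.card α * ‖y‖ < 1) :
    Summable fun T : Datum α => ‖weight A B y T‖ := by
  have h1 : Summable fun ρ : Perm α => ‖cycTrace A ρ‖ := Summable.of_finite
  have h2 : Summable fun ρ : Perm α => ‖cycTrace B ρ‖ := Summable.of_finite
  have h3 := summable_pow_walkLength (α := α) ‖y‖ (norm_nonneg y) h
  have := h1.mul_of_nonneg (h2.mul_of_nonneg h3 (fun _ => norm_nonneg _)
    (fun L => by simp only [Pi.zero_apply]; positivity)) (fun _ => norm_nonneg _)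
    (fun L => by simp only [Pi.zero_apply]; positivity)
  refine this.congr fun T => ?_
  simp [weight, mul_assoc]

/-- The weighted sum over all configurations in the set `P`. -/
def configSum (P : Set (Datum α)) : ℂ :=
  ∑' T, ({T | IsConfig T} ∩ P).indicator (weight A B y) T

theorem summable_norm_indicator_weight (h : Fintype.card α * ‖y‖ < 1) (P : Set (Datum α)) :
    Summable fun T : Datum α => ‖P.indicator (weight A B y) T‖ := by
  refine (summable_norm_weight A B y h).of_nonneg_of_le (fun _ => norm_nonneg _) fun T => ?_
  exact norm_indicator_le_norm_self _ _

/-- Every datum in `P` preserves the left part, hence is merged from a unique pair, and membership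
in `P` only constrains the left member. Weights are multiplicative, and absolute convergence turns
the double sum into a product. -/
theorem configSum_merge (e : β ⊕ γ ≃ α) (hl : StrictMono fun b => e (Sum.inl b))
    (hr : StrictMono fun c => e (Sum.inr c)) (h : Fintype.card α * ‖y‖ < 1)
    (P : Set (Datum α)) (Q : Set (Datum β))
    (hP : ∀ T ∈ P, Inv T (Set.range fun b => e (Sum.inl b)))
    (hPQ : ∀ p, mergeDatum e p ∈ P ↔ p.1 ∈ Q) :
    configSum A B y P = configSum A B y Q * configSum A B y (Set.univ : Set (Datum γ)) := by
  have hcard := Fintype.card_congr e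
  rw [Fintype.card_sum] at hcard
  have hβ : Fintype.card β * ‖y‖ < 1 := by
    refine lt_of_le_of_lt (mul_le_mul_of_nonneg_right ?_ (norm_nonneg y)) h
    exact_mod_cast (by omega : Fintype.card β ≤ Fintype.card α)
  have hγ : Fintype.card γ * ‖y‖ < 1 := by
    refine lt_of_le_of_lt (mul_le_mul_of_nonneg_right ?_ (norm_nonneg y)) h
    exact_mod_cast (by omega : Fintype.card γ ≤ Fintype.card α)
  unfold configSum
  rw [tsum_mul_tsum_of_summable_norm (summable_norm_indicator_weight A B y hβ _)
    (summable_norm_indicator_weight A B y hγ _), ← (mergeDatum_injective e).tsum_eq]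
  · refine tsum_congr fun p => ?_
    classical
    simp only [Set.indicator_apply, Set.mem_inter_iff, Set.mem_ofPred_eq, isConfig_merge e hl hr,
      hPQ, weight_merge, Set.mem_univ, and_true]
    by_cases h1 : IsConfig p.1 <;> by_cases h2 : IsConfig p.2 <;> by_cases h3 : p.1 ∈ Q <;>
      simp [h1, h2, h3]
  · intro T hT
    have : T ∈ P := by
      by_contra hn
      simp [hn] at hT
    exact exists_mergeDatum e T (hP T this)

theorem configSum_fin_zero : configSum A B y (Set.univ : Set (Datum (Fin 0))) = 1 := by
  unfold configSum
  rw [tsum_eq_single (1, 1, fun _ => [])]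
  · have : IsConfig ((1, 1, fun _ => []) : Datum (Fin 0)) :=
      ⟨fun t => t.elim0, Subsingleton.elim _ _⟩
    simp [this, weight, cycTrace, walkLength]
  · intro T hT
    exact absurd (Subsingleton.elim _ _) hT

/-- The weighted sum over all configurations on `d` points. -/
def partitionFn (d : ℕ) : ℂ := configSum A B y (Set.univ : Set (Datum (Fin d)))

/-- The weighted sum over all transitive configurations on `d` points. -/
def connectedFn (d : ℕ) : ℂ := configSum A B y {T : Datum (Fin d) | Trans T}

/-- Invariance under relabelling by an order isomorphism, obtained as the case of `configSum_merge`
in which the second part is empty. The next lemma does the same for transitive data. -/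
theorem configSum_univ (h : Fintype.card α * ‖y‖ < 1) :
    configSum A B y (Set.univ : Set (Datum α)) = partitionFn A B y (Fintype.card α) := by
  let o := Fintype.orderIsoFinOfCardEq α rfl
  have := configSum_merge A B y ((Equiv.sumEmpty (Fin (Fintype.card α)) (Fin 0)).trans o.toEquiv)
    (fun a b hab => by simpa using hab) (fun a => a.elim0) h Set.univ Set.univ ?_ (by simp)
  · rwa [configSum_fin_zero, mul_one] at this
  · intro T _
    have : (Set.range fun b => ((Equiv.sumEmpty (Fin (Fintype.card α)) (Fin 0)).trans o.toEquiv)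
        (Sum.inl b)) = Set.univ := by
      rw [Set.range_eq_univ]; intro a; exact ⟨o.symm a, by simp⟩
    rw [this]
    simp [Inv]

theorem configSum_trans [Nonempty α] (h : Fintype.card α * ‖y‖ < 1) :
    configSum A B y {T : Datum α | Trans T} = connectedFn A B y (Fintype.card α) := by
  let o := Fintype.orderIsoFinOfCardEq α rfl
  let e := (Equiv.sumEmpty (Fin (Fintype.card α)) (Fin 0)).trans o.toEquiv
  have hr : (Set.range fun b => e (Sum.inl b)) = Set.univ := by
    rw [Set.range_eq_univ]; intro a; exact ⟨o.symm a, by simp [e]⟩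
  have := configSum_merge A B y e
    (fun a b hab => by simpa [e] using hab) (fun a => a.elim0) h {T : Datum α | Trans T}
      {T | Trans T} ?_ ?_
  · rwa [configSum_fin_zero, mul_one] at this
  · intro T _
    rw [hr]
    simp [Inv]
  · intro p
    obtain ⟨a⟩ := ‹Nonempty α›
    have h1 := orbitOf_merge_iff e p (o.symm a)
    rw [hr] at h1
    rw [Set.mem_ofPred_eq, Set.mem_ofPred_eq, ← h1, trans_iff _ (e (Sum.inl (o.symm a)))]
    refine ⟨fun h2 => h2 _ (inv_orbitOf _ _) (mem_orbitOf _ _), fun h2 S hS hx => ?_⟩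
    exact Set.univ_subset_iff.mp (h2 ▸ orbitOf_subset hS hx)

theorem configSum_orbit (h : Fintype.card α * ‖y‖ < 1) (x : α) (S : Finset α) (hx : x ∈ S) :
    configSum A B y {T : Datum α | orbitOf T x = S} =
      connectedFn A B y S.card * partitionFn A B y (Fintype.card α - S.card) := by
  let e := Equiv.sumCompl (· ∈ S)
  have hr : (Set.range fun b => e (Sum.inl b)) = S := by
    ext a
    simp [e]
  have hβ : Fintype.card {a // a ∈ S} * ‖y‖ < 1 := by
    refine lt_of_le_of_lt (mul_le_mul_of_nonneg_right ?_ (norm_nonneg y)) h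
    exact_mod_cast Fintype.card_subtype_le _
  have hγ : Fintype.card {a // a ∉ S} * ‖y‖ < 1 := by
    refine lt_of_le_of_lt (mul_le_mul_of_nonneg_right ?_ (norm_nonneg y)) h
    exact_mod_cast Fintype.card_subtype_le _
  have hne : Nonempty {a // a ∈ S} := ⟨⟨x, hx⟩⟩
  rw [configSum_merge A B y e (fun a b hab => hab) (fun a b hab => hab) h
    {T : Datum α | orbitOf T x = S} {T | Trans T}, configSum_trans A B y hβ,
    configSum_univ A B y hγ]
  · simp [Fintype.card_subtype_compl]
  · intro T hT
    rw [hr, ← show orbitOf T x = S from hT]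
    exact inv_orbitOf T x
  · intro p
    rw [Set.mem_ofPred_eq, Set.mem_ofPred_eq, ← orbitOf_merge_iff e p ⟨x, hx⟩, hr]
    rfl

/-- The exponential formula in recursive form: classify configurations by the orbit of 0. An orbit
of size k + 1 is chosen in `n.choose k` ways, carries a transitive configuration, and leaves an
arbitrary one on its complement. -/
theorem partitionFn_succ (n : ℕ) (h : (n + 1 : ℕ) * ‖y‖ < 1) :
    partitionFn A B y (n + 1) =
      ∑ k ∈ Finset.range (n + 1), (n.choose k : ℂ) * connectedFn A B y (k + 1) *
        partitionFn A B y (n - k) := by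
  have hc : Fintype.card (Fin (n + 1)) * ‖y‖ < 1 := by simpa using h
  have h1 : partitionFn A B y (n + 1) = ∑ S ∈ (Finset.univ.erase (0 : Fin (n + 1))).powerset,
      configSum A B y {T : Datum (Fin (n + 1)) | orbitOf T 0 = (insert 0 S : Finset _)} := by
    unfold partitionFn configSum
    rw [← Summable.tsum_finsetSum]
    · refine tsum_congr fun T => ?_
      classical
      -- The sum runs over the orbit with 0 removed, so exactly one index is nonzero for each `T`.
      let S₀ := (orbitOf T 0).toFinset.erase 0
      have h0 : insert 0 S₀ = (orbitOf T 0).toFinset :=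
        Finset.insert_erase (by simpa using mem_orbitOf T 0)
      rw [Finset.sum_eq_single S₀]
      · have : orbitOf T 0 = (insert 0 S₀ : Finset _) := by rw [h0]; simp
        simp only [Set.indicator_apply, Set.mem_inter_iff, Set.mem_univ, Set.mem_ofPred_eq, this]
      · intro S hS hne
        rw [Set.indicator_of_notMem]
        rintro ⟨_, hT⟩
        apply hne
        have hT : orbitOf T 0 = (insert 0 S : Finset _) := hT
        have h3 : (0 : Fin (n + 1)) ∉ S := fun hm => by
          simpa using Finset.mem_powerset.mp hS hm
        simp only [S₀]
        rw [← Finset.erase_insert h3]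
        congr 1
        ext a
        simp [hT]
      · intro hn
        exact absurd (Finset.mem_powerset.mpr (Finset.erase_subset_erase _ (Finset.subset_univ _))) hn
    · intro S _
      exact (summable_norm_indicator_weight A B y hc _).of_norm
  rw [h1]
  have h2 : ∀ S ∈ (Finset.univ.erase (0 : Fin (n + 1))).powerset,
      configSum A B y {T : Datum (Fin (n + 1)) | orbitOf T 0 = (insert 0 S : Finset _)} =
      (fun k => connectedFn A B y (k + 1) * partitionFn A B y (n - k)) S.card := by
    intro S hS
    have h3 : (0 : Fin (n + 1)) ∉ S := fun hm => by
      simpa using Finset.mem_powerset.mp hS hm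
    rw [configSum_orbit A B y hc 0 _ (Finset.mem_insert_self _ _), Finset.card_insert_of_notMem h3]
    simp
  rw [Finset.sum_congr rfl h2,
    Finset.sum_powerset_apply_card fun k => connectedFn A B y (k + 1) * partitionFn A B y (n - k)]
  simp [mul_assoc]

end ConfigSum
-- Traces of permuted tensor powers as products over cycles.
section CycleTraces

set_option linter.unusedSectionVars false

variable {α β γ : Type} [Fintype α] [LinearOrder α] [Fintype β] [LinearOrder β]
  [Fintype γ] [LinearOrder γ] {N : ℕ} (A : Matrix (Fin N) (Fin N) ℂ)

theorem mergePerm_left_eq_extendDomain (e : β ⊕ γ ≃ α) (π : Perm β)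
    [DecidablePred (· ∈ Set.range fun b => e (Sum.inl b))] :
    mergePerm e (π, 1) = π.extendDomain
      (Equiv.ofInjective (fun b => e (Sum.inl b)) fun x y h => by simpa using h) := by
  ext a
  obtain ⟨b | c, rfl⟩ := e.surjective a
  · rw [mergePerm_inl]
    exact (Perm.extendDomain_apply_image π
      (Equiv.ofInjective (fun b => e (Sum.inl b)) fun x y h => by simpa using h) b).symm
  · rw [mergePerm_inr, Perm.extendDomain_apply_not_subtype]
    · rfl
    · simp

theorem mergePerm_right_eq_extendDomain (e : β ⊕ γ ≃ α) (π : Perm γ)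
    [DecidablePred (· ∈ Set.range fun b => e (Sum.inr b))] :
    mergePerm e (1, π) = π.extendDomain
      (Equiv.ofInjective (fun b => e (Sum.inr b)) fun x y h => by simpa using h) := by
  ext a
  obtain ⟨b | c, rfl⟩ := e.surjective a
  · rw [mergePerm_inl, Perm.extendDomain_apply_not_subtype]
    · rfl
    · simp
  · rw [mergePerm_inr]
    exact (Perm.extendDomain_apply_image π
      (Equiv.ofInjective (fun b => e (Sum.inr b)) fun x y h => by simpa using h) c).symm

theorem cycleType_mergePerm (e : β ⊕ γ ≃ α) (p : Perm β × Perm γ) :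
    (mergePerm e p).cycleType = p.1.cycleType + p.2.cycleType := by
  classical
  have h : p = (p.1, 1) * (1, p.2) := by simp
  have hd : (mergePerm e (p.1, 1)).Disjoint (mergePerm e (1, p.2)) := by
    intro a
    obtain ⟨b | c, rfl⟩ := e.surjective a
    · right; simp
    · left; simp
  rw [h, map_mul, hd.cycleType_mul, mergePerm_left_eq_extendDomain,
    mergePerm_right_eq_extendDomain, Perm.cycleType_extendDomain, Perm.cycleType_extendDomain]
  simp

theorem parts_mergePerm (e : β ⊕ γ ≃ α) (p : Perm β × Perm γ) :
    (mergePerm e p).partition.parts = p.1.partition.parts + p.2.partition.parts := by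
  have hcard := Fintype.card_congr e
  rw [Fintype.card_sum] at hcard
  have h1 := Perm.sum_cycleType_le p.1
  have h2 := Perm.sum_cycleType_le p.2
  simp only [Perm.parts_partition, ← Perm.sum_cycleType, cycleType_mergePerm, Multiset.sum_add]
  rw [← hcard, show Fintype.card β + Fintype.card γ - (p.1.cycleType.sum + p.2.cycleType.sum) =
    (Fintype.card β - p.1.cycleType.sum) + (Fintype.card γ - p.2.cycleType.sum) by omega,
    Multiset.replicate_add]
  abel

/-- The expansion of a matrix power over index paths from `b` to `a`. Factor k is indexed by (next
vertex, current vertex), which matches the convention A (i (ρ k)) (i k) of `cycTrace` for ρ the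
rotation. -/
theorem pow_succ_apply_eq_sum (n : ℕ) (a b : Fin N) :
    (A ^ (n + 1)) a b = ∑ i : Fin n → Fin N, ∏ k : Fin (n + 1),
      A ((Fin.snoc i a : Fin (n + 1) → Fin N) k) ((Fin.cons b i : Fin (n + 1) → Fin N) k) := by
  induction n generalizing b with
  | zero => simp [Fin.snoc]
  | succ n ih =>
    rw [pow_succ, Matrix.mul_apply, ← (Fin.consEquiv fun _ => Fin N).sum_comp,
      Fintype.sum_prod_type]
    refine Finset.sum_congr rfl fun c _ => ?_
    rw [ih, Finset.sum_mul]
    refine Finset.sum_congr rfl fun i _ => ?_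
    simp only [Fin.consEquiv, Equiv.coe_fn_mk]
    refine Eq.trans ?_ (Fin.prod_univ_succ _).symm
    rw [mul_comm]
    congr 1
    refine Finset.prod_congr rfl fun k _ => ?_
    rw [← Fin.cons_snoc_eq_snoc_cons]
    simp

theorem cycTrace_finRotate (n : ℕ) :
    cycTrace A (finRotate (n + 1)) = Matrix.trace (A ^ (n + 1)) := by
  unfold cycTrace Matrix.trace
  rw [← (Fin.consEquiv fun _ => Fin N).sum_comp, Fintype.sum_prod_type]
  refine Finset.sum_congr rfl fun b _ => ?_
  rw [Matrix.diag_apply, pow_succ_apply_eq_sum]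
  refine Finset.sum_congr rfl fun i _ => Finset.prod_congr rfl fun k _ => ?_
  simp only [Fin.consEquiv, Equiv.coe_fn_mk]
  congr 1
  induction k using Fin.lastCases with
  | last => simp
  | cast k => simp

theorem cycTrace_permCongr (e : β ≃ α) (ρ : Perm β) :
    cycTrace A (e.permCongr ρ) = cycTrace A ρ := by
  unfold cycTrace
  rw [← (e.arrowCongr (Equiv.refl (Fin N))).sum_comp]
  refine Finset.sum_congr rfl fun i _ => ?_
  rw [← e.prod_comp]
  simp [Equiv.arrowCongr]

theorem cycleType_permCongr (e : β ≃ α) (ρ : Perm β) :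
    (e.permCongr ρ).cycleType = ρ.cycleType := by
  have := cycleType_mergePerm ((Equiv.sumEmpty β (Fin 0)).trans e) (ρ, 1)
  rw [show mergePerm ((Equiv.sumEmpty β (Fin 0)).trans e) (ρ, 1) = e.permCongr ρ by
    ext a
    obtain ⟨b, rfl⟩ := e.surjective a
    have := mergePerm_inl ((Equiv.sumEmpty β (Fin 0)).trans e) (ρ, 1) b
    simpa using this] at this
  simpa using this

/-- A permutation with a single cycle is conjugate to the rotation, and `cycTrace` is conjugation
invariant. -/
theorem cycTrace_of_sameCycle (ρ : Perm α) (x : α) (h : ∀ a, ρ.SameCycle x a) :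
    cycTrace A ρ = (ρ.partition.parts.map fun k => Matrix.trace (A ^ k)).prod := by
  have hpos : 0 < Fintype.card α := Fintype.card_pos_iff.mpr ⟨x⟩
  obtain ⟨n, hn⟩ : ∃ n, Fintype.card α = n + 1 := ⟨_, (Nat.succ_pred_eq_of_pos hpos).symm⟩
  let e : α ≃ Fin (n + 1) := Fintype.equivFinOfCardEq hn
  have hconj : IsConj (e.permCongr ρ) (finRotate (n + 1)) := by
    -- A single point is separate: its only permutation is the identity, which is not a cycle in the
    -- sense of `IsCycle`.
    obtain rfl | ⟨m, rfl⟩ : n = 0 ∨ ∃ m, n = m + 1 := by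
      cases n <;> simp
    · rw [show e.permCongr ρ = finRotate (0 + 1) from
        Equiv.ext fun a => Subsingleton.elim (α := Fin 1) _ _]
    · rw [Perm.isConj_iff_cycleType_eq, cycleType_finRotate, cycleType_permCongr]
      have hmov : ∀ a, ρ a ≠ a := by
        intro a ha
        have : Subsingleton α := by
          refine ⟨fun b c => ?_⟩
          have h1 : ∀ b, a = b := fun b => ((h a).symm.trans (h b)).eq_of_left ha
          rw [← h1 b, ← h1 c]
        have := Fintype.card_le_one_iff_subsingleton.mpr this
        omega
      have hc : ρ.IsCycle := ⟨x, hmov x, fun b _ => h b⟩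
      rw [hc.cycleType]
      have : ρ.support = Finset.univ := by ext a; simp [hmov a]
      rw [this, Finset.card_univ, hn]
  obtain ⟨τ, hτ⟩ := isConj_iff.mp hconj
  have h1 : cycTrace A ρ = Matrix.trace (A ^ (n + 1)) := by
    rw [← cycTrace_finRotate, ← hτ, ← cycTrace_permCongr A e ρ,
      ← cycTrace_permCongr A τ (e.permCongr ρ)]
    rfl
  have h2 : ρ.partition.parts = {n + 1} := by
    have h3 : ρ.cycleType = (finRotate (n + 1)).cycleType := by
      rw [← Perm.isConj_iff_cycleType_eq.mp hconj, cycleType_permCongr]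
    rw [Perm.parts_partition, ← Perm.sum_cycleType, h3, hn]
    cases n with
    | zero =>
      rw [show finRotate (0 + 1) = 1 from
        Equiv.ext fun a => Subsingleton.elim (α := Fin 1) _ _]
      simp
    | succ m => rw [cycleType_finRotate]; simp
  rw [h1, h2]
  simp

/-- Induction on the number of points, splitting off the cycle of `x`; both sides are multiplicative
under `mergePerm`. -/
theorem cycTrace_eq_prod_aux (n : ℕ) : ∀ (α : Type) [Fintype α] [LinearOrder α],
    Fintype.card α = n → ∀ ρ : Perm α,
      cycTrace A ρ = (ρ.partition.parts.map fun k => Matrix.trace (A ^ k)).prod := by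
  induction n using Nat.strong_induction_on with
  | _ n ih =>
    intro α _ _ hn ρ
    classical
    rcases isEmpty_or_nonempty α with hα | ⟨⟨x⟩⟩
    · have h1 : ρ.partition.parts = 0 := by
        rw [Perm.parts_partition, Subsingleton.elim ρ 1]
        simp
      rw [h1]
      simp [cycTrace]
    · by_cases h : ∀ a, ρ.SameCycle x a
      · exact cycTrace_of_sameCycle A ρ x h
      · push Not at h
        obtain ⟨z, hz⟩ := h
        let e := Equiv.sumCompl (ρ.SameCycle x)
        obtain ⟨p, hp⟩ := exists_mergePerm e ρ (by
          have hr : (Set.range fun b => e (Sum.inl b)) = {a | ρ.SameCycle x a} := by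
            ext a
            simp [e]
          intro a
          rw [hr]
          exact Perm.sameCycle_apply_right)
        have hc := Fintype.card_congr e
        rw [Fintype.card_sum] at hc
        have h1 : 0 < Fintype.card {a // ρ.SameCycle x a} :=
          Fintype.card_pos_iff.mpr ⟨⟨x, Perm.SameCycle.refl _ _⟩⟩
        have h2 : 0 < Fintype.card {a // ¬ρ.SameCycle x a} :=
          Fintype.card_pos_iff.mpr ⟨⟨z, hz⟩⟩
        rw [← hp, cycTrace_merge, parts_mergePerm, Multiset.map_add, Multiset.prod_add,
          ih _ (by omega) _ rfl p.1, ih _ (by omega) _ rfl p.2]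

/-- The trace of `ρ ∘ A^{⊗ α}` is the product of the traces `Tr (A ^ k)` over the cycles of `ρ`. -/
theorem cycTrace_eq_prod (ρ : Perm α) :
    cycTrace A ρ = (ρ.partition.parts.map fun k => Matrix.trace (A ^ k)).prod :=
  cycTrace_eq_prod_aux A _ α rfl ρ

/-- This is `cycTrace_eq_prod` for the 2 × 2 identity matrix: the left side counts the two-valued
functions constant along ρ, and every cycle contributes a trace equal to 2. It turns the number of
cycles into a dimension below. -/
theorem card_invariant_functions (ρ : Perm α) :
    Nat.card {f : α → Fin 2 // ∀ a, f (ρ a) = f a} = 2 ^ Multiset.card ρ.partition.parts := by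
  have h := cycTrace_eq_prod (1 : Matrix (Fin 2) (Fin 2) ℂ) ρ
  have h1 : (ρ.partition.parts.map fun k => Matrix.trace ((1 : Matrix (Fin 2) (Fin 2) ℂ) ^ k)).prod
      = 2 ^ Multiset.card ρ.partition.parts := by
    simp
  have h2 : cycTrace (1 : Matrix (Fin 2) (Fin 2) ℂ) ρ =
      (Nat.card {f : α → Fin 2 // ∀ a, f (ρ a) = f a} : ℂ) := by
    unfold cycTrace
    have : ∀ i : α → Fin 2, ∏ k, (1 : Matrix (Fin 2) (Fin 2) ℂ) (i (ρ k)) (i k) =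
        if ∀ a, i (ρ a) = i a then 1 else 0 := by
      intro i
      simp only [Matrix.one_apply]
      rw [Finset.prod_ite_zero]
      simp
    simp_rw [this]
    rw [Finset.sum_boole, Nat.card_eq_fintype_card, Fintype.card_subtype]
  rw [h1, h2] at h
  exact_mod_cast h

end CycleTraces
-- Scott's lemma and the genus inequality.
section Genus

set_option linter.unusedSectionVars false

theorem finrank_span_singleton_le_one {K V : Type*} [Field K] [AddCommGroup V] [Module K V]
    (v : V) : Module.finrank K (Submodule.span K {v}) ≤ 1 := by
  simpa using finrank_span_le_card (R := K) ({v} : Set V)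

/-- **Scott's lemma**: endomorphisms whose product is the identity, with common fixed space of
dimension at most one and common cofixed space of dimension at most one, have ranks of `T i - 1`
adding up to at least `2 (dim V - 1)`. -/
theorem two_mul_finrank_le_of_prod_eq_one {K V : Type*} [Field K] [AddCommGroup V] [Module K V]
    [FiniteDimensional K V] (T : ℕ → Module.End K V) (n : ℕ)
    (hT : ((List.range n).map T).prod = 1) (v₀ : V)
    (hK : ∀ v, (∀ i < n, T i v = v) → v ∈ Submodule.span K {v₀})
    (hW : ∀ W : Submodule K V, (∀ i < n, ∀ v, T i v - v ∈ W) →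
      Module.finrank K V ≤ Module.finrank K W + 1) :
    2 * Module.finrank K V ≤
      2 + ∑ i ∈ Finset.range n, Module.finrank K (LinearMap.range (T i - 1)) := by
  set P : ℕ → Module.End K V := fun m => ((List.range m).map T).prod with hPdef
  have hPs : ∀ m v, P (m + 1) v = P m (T m v) := by
    intro m v
    simp [P, List.range_succ]
  have hP0 : ∀ v, P 0 v = v := fun v => by simp [P]
  let R : Fin n → Submodule K V := fun i => LinearMap.range (T i - 1)
  -- With P i the product of the first i operators, the maps b : v ↦ ((T i - 1) v) and δ : w ↦ ∑ P i
  -- (w i) compose to the telescoping sum P n - 1 = 0. Hence rank b ≤ dim ker δ, and ∑ rank (T i -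
  -- 1) ≥ rank δ + rank b. Both ranks are at least dim V - 1: ker b is the common fixed space, and
  -- range δ contains the range of every T i - 1.
  let b : V →ₗ[K] ((i : Fin n) → R i) := LinearMap.pi fun i => (T i - 1).rangeRestrict
  let δ : ((i : Fin n) → R i) →ₗ[K] V :=
    ∑ i : Fin n, (P i) ∘ₗ (R i).subtype ∘ₗ LinearMap.proj i
  have hδ : ∀ w, δ w = ∑ i : Fin n, P i (w i : V) := by
    intro w; simp [δ]
  have hcomp : LinearMap.range b ≤ LinearMap.ker δ := by
    rintro _ ⟨v, rfl⟩
    rw [LinearMap.mem_ker, hδ]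
    have h1 : ∀ i : Fin n, P i ((b v i : R i) : V) = P (i + 1) v - P i v := by
      intro i
      rw [hPs, ← map_sub]
      rfl
    simp_rw [h1]
    rw [Fin.sum_univ_eq_sum_range (fun i => P (i + 1) v - P i v), Finset.sum_range_sub (fun i => P i v)]
    simp [P, hT]
  -- A simultaneous induction: modulo range δ the operator P m is the identity, so P m (T m v - v)
  -- in the range forces T m v - v in the range as well.
  have hrange : ∀ m ≤ n, (∀ v, P m v - v ∈ LinearMap.range δ) ∧
      ∀ i < m, ∀ v, T i v - v ∈ LinearMap.range δ := by
    intro m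
    induction m with
    | zero => intro _; simp [hP0]
    | succ m ih =>
      intro hm
      obtain ⟨h1, h2⟩ := ih (by omega)
      have h3 : ∀ v, T m v - v ∈ LinearMap.range δ := by
        intro v
        have h4 : P m (T m v - v) ∈ LinearMap.range δ := by
          refine ⟨Pi.single ⟨m, hm⟩ ⟨T m v - v, v, rfl⟩, ?_⟩
          rw [hδ, Finset.sum_eq_single ⟨m, hm⟩]
          · simp
          · intro j _ hj
            simp [Pi.single_eq_of_ne hj]
          · simp
        have := Submodule.sub_mem _ h4 (h1 (T m v - v))
        simpa using this
      refine ⟨fun v => ?_, fun i hi v => ?_⟩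
      · rw [hPs]
        have := Submodule.add_mem _ (h1 (T m v)) (h3 v)
        simpa using this
      · rcases Nat.lt_succ_iff_lt_or_eq.mp hi with h | rfl
        · exact h2 i h v
        · exact h3 v
  have hker : Module.finrank K (LinearMap.ker b) ≤ 1 := by
    refine (Submodule.finrank_mono (t := Submodule.span K {v₀}) ?_).trans
      (finrank_span_singleton_le_one v₀)
    intro v hv
    refine hK v fun i hi => ?_
    have := congrArg (fun w => ((w ⟨i, hi⟩ : R ⟨i, hi⟩) : V)) (LinearMap.mem_ker.mp hv)
    exact sub_eq_zero.mp this
  have e1 := LinearMap.finrank_range_add_finrank_ker b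
  have e2 := LinearMap.finrank_range_add_finrank_ker δ
  have e3 := Submodule.finrank_mono hcomp
  have e4 := hW (LinearMap.range δ) (hrange n le_rfl).2
  have e5 : Module.finrank K ((i : Fin n) → R i) =
      ∑ i ∈ Finset.range n, Module.finrank K (LinearMap.range (T i - 1)) := by
    rw [Module.finrank_pi_fintype]
    exact Fin.sum_univ_eq_sum_range (fun i => Module.finrank K (LinearMap.range (T i - 1))) n
  omega

variable {α : Type} [Fintype α] [LinearOrder α]

/-- The representation of the permutations of `α` on functions with values in `ZMod 2`. -/
def permRep (α : Type) : Perm α →* Module.End (ZMod 2) (α → ZMod 2) where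
  toFun g := LinearMap.funLeft (ZMod 2) (ZMod 2) (g⁻¹ : Perm α)
  map_one' := rfl
  map_mul' g h := by
    ext f a
    simp [LinearMap.funLeft, mul_inv_rev]

theorem permRep_apply (g : Perm α) (f : α → ZMod 2) (a : α) :
    permRep α g f a = f (g⁻¹ a) := rfl

/-- The kernel of g - 1 consists of the functions constant on the cycles of g. Over `ZMod 2` its
dimension can be read off from its cardinality, 2 to the number of cycles. -/
theorem finrank_range_permRep (g : Perm α) :
    Module.finrank (ZMod 2) (LinearMap.range (permRep α g - 1)) +
      Multiset.card g.partition.parts = Fintype.card α := by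
  have h1 := LinearMap.finrank_range_add_finrank_ker (permRep α g - 1)
  rw [Module.finrank_fintype_fun_eq_card] at h1
  have h2 : Nat.card (LinearMap.ker (permRep α g - 1)) =
      Nat.card {f : α → Fin 2 // ∀ a, f (g a) = f a} := by
    refine Nat.card_congr (Equiv.subtypeEquivRight fun f => ?_)
    rw [LinearMap.mem_ker, LinearMap.sub_apply, sub_eq_zero, funext_iff]
    refine ⟨fun h a => ?_, fun h a => ?_⟩
    · have h3 : f (g⁻¹ (g a)) = f (g a) := h (g a)
      rw [Perm.coe_inv, symm_apply_apply] at h3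
      exact h3.symm
    · have h3 : f (g (g⁻¹ a)) = f (g⁻¹ a) := h (g⁻¹ a)
      rw [Perm.coe_inv, apply_symm_apply] at h3
      exact h3.symm
  rw [card_invariant_functions, Module.natCard_eq_pow_finrank (K := ZMod 2)] at h2
  have h3 := Nat.pow_right_injective (le_of_eq (ZMod.card 2).symm) (by simpa using h2)
  omega

/-- The list of transpositions of a walk. -/
def walkSteps (L : α → List α) : List (α × α) :=
  (Finset.univ.sort (· ≤ ·)).flatMap fun t => (L t).map fun s => (s, t)

theorem walkPerm_eq_prod (L : α → List α) :
    walkPerm L = ((walkSteps L).map fun p => swap p.1 p.2).prod := by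
  unfold walkPerm walkSteps stepPerm
  generalize (Finset.univ.sort (α := α) (· ≤ ·)) = l
  induction l with
  | nil => simp
  | cons t l ih => simp [ih, Function.comp_def]

theorem mem_walkSteps {L : α → List α} {p : α × α} : p ∈ walkSteps L ↔ p.1 ∈ L p.2 := by
  simp only [walkSteps, List.mem_flatMap, Finset.mem_sort, Finset.mem_univ, true_and,
    List.mem_map, Prod.ext_iff]
  exact ⟨fun ⟨t, s, h, h1, h2⟩ => h2 ▸ h1 ▸ h, fun h => ⟨p.2, p.1, h, rfl, rfl⟩⟩

theorem length_walkSteps (L : α → List α) : (walkSteps L).length = walkLength L := by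
  simp only [walkSteps, List.length_flatMap, List.length_map, walkLength]
  have h := Finset.sort_toFinset (s := (Finset.univ : Finset α)) (r := (· ≤ ·))
  rw [← List.sum_toFinset _ (Finset.sort_nodup (Finset.univ : Finset α) (· ≤ ·)), h]

theorem card_parts_swap {s t : α} (h : s ≠ t) :
    Multiset.card (swap s t).partition.parts + 1 = Fintype.card α := by
  rw [Perm.parts_partition, ← Perm.sum_cycleType,
    Perm.isSwap_iff_cycleType.mp ⟨s, t, h, rfl⟩]
  have : 2 ≤ Fintype.card α := by
    rw [← Finset.card_pair h]
    exact Finset.card_le_univ _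
  simp
  omega

/-- Scott's lemma for the permutation module. By transitivity the common fixed vectors are
constants, and a subspace containing all (g - 1) v contains every difference of two basis vectors,
hence has codimension at most one. -/
theorem two_mul_card_le_of_trans (gs : List (Perm α)) (hgs : gs.prod = 1)
    (htr : ∀ S : Set α, (∀ g ∈ gs, ∀ a, g a ∈ S ↔ a ∈ S) → S.Nonempty → S = Set.univ) :
    2 * Fintype.card α ≤ 2 +
      (gs.map fun g => Module.finrank (ZMod 2) (LinearMap.range (permRep α g - 1))).sum := by
  rcases isEmpty_or_nonempty α with h0 | ⟨⟨x⟩⟩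
  · simp
  have hrange : gs = (List.range gs.length).map fun i => gs.getD i 1 := by
    refine List.ext_getElem (by simp) fun i h1 h2 => ?_
    simp [h1]
  have hmem : ∀ g ∈ gs, ∃ i < gs.length, gs.getD i 1 = g := by
    intro g hg
    rw [hrange] at hg
    simpa using hg
  have key := two_mul_finrank_le_of_prod_eq_one (K := ZMod 2) (V := α → ZMod 2)
    (fun i => permRep α (gs.getD i 1)) gs.length ?_ (fun _ => 1) ?_ ?_
  · rw [Module.finrank_fintype_fun_eq_card] at key
    refine key.trans_eq ?_
    congr 1
    conv_rhs => rw [hrange]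
    rw [List.map_map, ← List.sum_toFinset _ List.nodup_range, List.toFinset_range]
    rfl
  · have : (List.range gs.length).map (fun i => permRep α (gs.getD i 1)) =
        ((List.range gs.length).map fun i => gs.getD i 1).map (permRep α) := by
      rw [List.map_map]; rfl
    rw [this, ← hrange, ← map_list_prod, hgs, map_one]
  · intro f hf
    have h1 : {a | f a = f x} = Set.univ := by
      refine htr _ (fun g hg a => ?_) ⟨x, rfl⟩
      obtain ⟨i, hi, rfl⟩ := hmem g hg
      have := congrFun (hf i hi) (gs.getD i 1 a)
      rw [permRep_apply, Perm.coe_inv, symm_apply_apply] at this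
      rw [Set.mem_ofPred_eq, Set.mem_ofPred_eq, this]
    refine Submodule.mem_span_singleton.mpr ⟨f x, ?_⟩
    ext a
    have : f a = f x := h1.ge (Set.mem_univ a)
    simp [this]
  · intro W hW
    have h1 : {a | (Pi.single a 1 - Pi.single x 1 : α → ZMod 2) ∈ W} = Set.univ := by
      refine htr _ (fun g hg a => ?_) ⟨x, by simp⟩
      obtain ⟨i, hi, rfl⟩ := hmem g hg
      set g := gs.getD i 1
      have h2 : permRep α g (Pi.single a 1) = Pi.single (g a) 1 := by
        ext b
        rw [permRep_apply]
        by_cases hb : b = g a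
        · subst hb; simp
        · rw [Pi.single_eq_of_ne hb, Pi.single_eq_of_ne]
          intro h; exact hb (by rw [← h]; simp)
      have h3 := hW i hi (Pi.single a 1)
      rw [h2] at h3
      have h4 : (Pi.single (g a) 1 - Pi.single x 1 : α → ZMod 2) =
          (Pi.single (g a) 1 - Pi.single a 1) + (Pi.single a 1 - Pi.single x 1) := by abel
      rw [Set.mem_ofPred_eq, Set.mem_ofPred_eq, h4]
      exact W.add_mem_iff_right h3
    have h5 : (⊤ : Submodule (ZMod 2) (α → ZMod 2)) ≤
        W ⊔ Submodule.span (ZMod 2) {Pi.single x 1} := by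
      intro f _
      rw [pi_eq_sum_univ' f]
      refine Submodule.sum_mem _ fun a _ => Submodule.smul_mem _ _ ?_
      have h6 : (Pi.single a 1 - Pi.single x 1 : α → ZMod 2) ∈ W := h1.ge (Set.mem_univ a)
      have h7 := Submodule.add_mem_sup h6
        (Submodule.mem_span_singleton_self (R := ZMod 2) (Pi.single x (1 : ZMod 2) : α → ZMod 2))
      rw [sub_add_cancel] at h7
      convert h7 using 1
    calc Module.finrank (ZMod 2) (α → ZMod 2)
        = Module.finrank (ZMod 2) (⊤ : Submodule (ZMod 2) (α → ZMod 2)) := (finrank_top _ _).symm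
      _ ≤ _ := Submodule.finrank_mono h5
      _ ≤ _ := Submodule.finrank_add_le_finrank_add_finrank _ _
      _ ≤ _ := Nat.add_le_add_left (finrank_span_singleton_le_one _) _

/-- The genus of a transitive factorization is nonnegative. -/
theorem card_parts_add_card_parts_le (T : Datum α) (hT : IsConfig T) (htr : Trans T) :
    Multiset.card T.1.partition.parts + Multiset.card T.2.1.partition.parts ≤
      walkLength T.2.2 + 2 := by
  obtain ⟨ρ, σ, L⟩ := T
  obtain ⟨hval, hprod⟩ := hT
  simp only at hval hprod ⊢
  -- The rank of g - 1 is d minus the number of cycles, which is 1 for a transposition, so the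
  -- inequality reads 2d ≤ 2 + (d - ℓ(ρ)) + (d - ℓ(σ)) + r.
  have key := two_mul_card_le_of_trans (ρ :: σ :: (walkSteps L).map fun p => swap p.1 p.2) ?_ ?_
  · have h1 : (((walkSteps L).map fun p => swap p.1 p.2).map fun g =>
        Module.finrank (ZMod 2) (LinearMap.range (permRep α g - 1))).sum = walkLength L := by
      rw [← length_walkSteps, List.map_map]
      have : ∀ p ∈ walkSteps L, ((fun g =>
          Module.finrank (ZMod 2) (LinearMap.range (permRep α g - 1))) ∘
            fun p : α × α => swap p.1 p.2) p = 1 := by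
        intro p hp
        have h2 := finrank_range_permRep (swap p.1 p.2)
        have h3 := card_parts_swap (hval _ _ (mem_walkSteps.mp hp)).ne
        simp only [Function.comp]
        omega
      rw [List.map_congr_left this]
      simp
    have h2 := finrank_range_permRep ρ
    have h3 := finrank_range_permRep σ
    simp only [List.map_cons, List.sum_cons, h1] at key
    omega
  · rw [List.prod_cons, List.prod_cons, ← walkPerm_eq_prod, ← mul_assoc, hprod]
  · intro S hS hne
    refine htr S ⟨fun a => hS ρ (by simp) a, fun a => hS σ (by simp) a, fun t s hs => ?_⟩ hne
    have h1 : (s, t) ∈ walkSteps L := mem_walkSteps.mpr hs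
    have := hS (swap s t) (by
      simp only [List.mem_cons, List.mem_map]
      exact Or.inr (Or.inr ⟨_, h1, rfl⟩)) t
    rwa [swap_apply_right] at this

end Genus
-- Tensor powers, and commutation with the unitary group made infinitesimal.
section Tensor

variable {ι : Type} [Fintype ι] [DecidableEq ι] {N : ℕ}

/-- The tensor power of a matrix. -/
def tensorPow (ι : Type) [Fintype ι] (V : Matrix (Fin N) (Fin N) ℂ) :
    Matrix (ι → Fin N) (ι → Fin N) ℂ :=
  Matrix.of fun i j => ∏ k, V (i k) (j k)

/-- The derivation `∑ k, 1 ⊗ ⋯ ⊗ H ⊗ ⋯ ⊗ 1` of tensor space induced by a matrix. -/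
def tensorDer (ι : Type) [Fintype ι] [DecidableEq ι] (H : Matrix (Fin N) (Fin N) ℂ) :
    Matrix (ι → Fin N) (ι → Fin N) ℂ :=
  Matrix.of fun i j => ∑ k, (∏ l ∈ Finset.univ.erase k, (1 : Matrix (Fin N) (Fin N) ℂ) (i l) (j l)) *
    H (i k) (j k)

theorem tensorPow_mul (V W : Matrix (Fin N) (Fin N) ℂ) :
    tensorPow ι (V * W) = tensorPow ι V * tensorPow ι W := by
  ext i j
  simp only [tensorPow, Matrix.mul_apply, Matrix.of_apply]
  rw [Finset.prod_univ_sum]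
  simp [Finset.prod_mul_distrib]

omit [DecidableEq ι] in
theorem tensorPow_one : tensorPow ι (1 : Matrix (Fin N) (Fin N) ℂ) = 1 := by
  ext i j
  simp only [tensorPow, Matrix.of_apply, Matrix.one_apply, Finset.prod_ite_zero]
  simp [funext_iff]

theorem tensorDer_add (H K : Matrix (Fin N) (Fin N) ℂ) :
    tensorDer ι (H + K) = tensorDer ι H + tensorDer ι K := by
  ext i j
  simp [tensorDer, mul_add, Finset.sum_add_distrib]

theorem tensorDer_smul (c : ℂ) (H : Matrix (Fin N) (Fin N) ℂ) :
    tensorDer ι (c • H) = c • tensorDer ι H := by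
  ext i j
  simp only [tensorDer, Matrix.of_apply, Matrix.smul_apply, smul_eq_mul, Finset.mul_sum]
  exact Finset.sum_congr rfl fun k _ => by ring

theorem sum_prod_erase_one (k : ι) (i : ι → Fin N) (X : (ι → Fin N) → ℂ) :
    ∑ i', (∏ l ∈ Finset.univ.erase k, (1 : Matrix (Fin N) (Fin N) ℂ) (i l) (i' l)) * X i' =
      ∑ a, X (Function.update i k a) := by
  have h : ∀ i' : ι → Fin N, (∏ l ∈ Finset.univ.erase k,
      (1 : Matrix (Fin N) (Fin N) ℂ) (i l) (i' l)) = if i' = Function.update i k (i' k) then 1 else 0 := by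
    intro i'
    simp only [Matrix.one_apply]
    rw [Finset.prod_ite_zero]
    simp only [Finset.mem_erase, Finset.mem_univ, and_true, Finset.prod_const_one]
    congr 1
    rw [eq_iff_iff]
    constructor
    · intro h
      funext l
      by_cases hl : l = k
      · subst hl; simp
      · simp [hl, h l hl]
    · intro h l hl
      rw [h]; simp [hl]
  simp_rw [h, ite_mul, one_mul, zero_mul]
  rw [← Finset.sum_filter]
  refine Finset.sum_bij' (fun i' _ => i' k) (fun a _ => Function.update i k a) ?_ ?_ ?_ ?_ ?_
  · simp
  · simp
  · intro i' hi'
    exact (Finset.mem_filter.mp hi').2.symm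
  · simp
  · intro i' hi'
    rw [← (Finset.mem_filter.mp hi').2]

theorem tensorDer_mul_apply (H : Matrix (Fin N) (Fin N) ℂ) (X : Matrix (ι → Fin N) (ι → Fin N) ℂ)
    (i j : ι → Fin N) :
    (tensorDer ι H * X) i j = ∑ k, ∑ a, H (i k) a * X (Function.update i k a) j := by
  simp only [Matrix.mul_apply, tensorDer, Matrix.of_apply, Finset.sum_mul]
  rw [Finset.sum_comm]
  refine Finset.sum_congr rfl fun k _ => ?_
  have := sum_prod_erase_one k i fun i' => H (i k) (i' k) * X i' j
  simp only [Function.update_self] at this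
  rw [← this]
  exact Finset.sum_congr rfl fun i' _ => by ring

theorem mul_tensorDer_apply (H : Matrix (Fin N) (Fin N) ℂ) (X : Matrix (ι → Fin N) (ι → Fin N) ℂ)
    (i j : ι → Fin N) :
    (X * tensorDer ι H) i j = ∑ k, ∑ a, H a (j k) * X i (Function.update j k a) := by
  simp only [Matrix.mul_apply, tensorDer, Matrix.of_apply, Finset.mul_sum]
  rw [Finset.sum_comm]
  refine Finset.sum_congr rfl fun k _ => ?_
  have := sum_prod_erase_one k j fun i' => H (i' k) (j k) * X i i'
  simp only [Function.update_self] at this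
  rw [← this]
  refine Finset.sum_congr rfl fun i' _ => ?_
  have h : ∀ l, (1 : Matrix (Fin N) (Fin N) ℂ) (i' l) (j l) = (1 : Matrix (Fin N) (Fin N) ℂ) (j l) (i' l) := by
    intro l; simp [Matrix.one_apply, eq_comm]
  simp_rw [h]
  ring

-- The curve is s ↦ exp(sH); a submultiplicative matrix norm is introduced only to differentiate it.
attribute [local instance] Matrix.linftyOpNormedRing Matrix.linftyOpNormedAlgebra in
theorem exists_unitary_curve (H : Matrix (Fin N) (Fin N) ℂ) (hH : star H = -H) :
    ∃ V : ℝ → Matrix (Fin N) (Fin N) ℂ, (∀ s, V s ∈ Matrix.unitaryGroup (Fin N) ℂ) ∧ V 0 = 1 ∧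
      ∀ a b, HasDerivAt (fun s => V s a b) (H a b) 0 := by
  refine ⟨fun s => NormedSpace.exp (s • H), fun s => ?_, by simp, fun a b => ?_⟩
  · rw [Matrix.mem_unitaryGroup_iff, Matrix.star_eq_conjTranspose, ← Matrix.exp_conjTranspose,
      ← Matrix.star_eq_conjTranspose, star_smul, hH, star_trivial, smul_neg, Matrix.exp_neg]
    exact Matrix.mul_nonsing_inv _ ((Matrix.isUnit_iff_isUnit_det _).mp (Matrix.isUnit_exp _))
  · have h := hasDerivAt_exp_smul_const (𝕂 := ℝ) H 0
    simp only [zero_smul, NormedSpace.exp_zero, one_mul] at h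
    let f : Matrix (Fin N) (Fin N) ℂ →L[ℝ] ℂ :=
      { toFun := fun X => X a b
        map_add' := fun _ _ => rfl
        map_smul' := fun _ _ => rfl
        cont := by fun_prop }
    exact f.hasFDerivAt.comp_hasDerivAt 0 h

/-- For skew-Hermitian H, differentiate the commutation relation along a unitary curve tangent to H
at the identity. The conclusion is complex linear in H, and every matrix is a complex combination of
two skew-Hermitian ones. -/
theorem commute_tensorDer_of_commute_tensorPow (X : Matrix (ι → Fin N) (ι → Fin N) ℂ)
    (hX : ∀ V ∈ Matrix.unitaryGroup (Fin N) ℂ, tensorPow ι V * X = X * tensorPow ι V)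
    (H : Matrix (Fin N) (Fin N) ℂ) : tensorDer ι H * X = X * tensorDer ι H := by
  have hskew : ∀ H : Matrix (Fin N) (Fin N) ℂ, star H = -H →
      tensorDer ι H * X = X * tensorDer ι H := by
    intro H hH
    obtain ⟨V, hV, hV0, hVd⟩ := exists_unitary_curve H hH
    have hd : ∀ i j, HasDerivAt (fun s => tensorPow ι (V s) i j) (tensorDer ι H i j) 0 := by
      intro i j
      have := HasDerivAt.fun_finsetProd (u := Finset.univ) (f := fun k s => V s (i k) (j k))
        (f' := fun k => H (i k) (j k)) (x := 0) fun k _ => hVd (i k) (j k)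
      simpa [tensorPow, tensorDer, hV0] using this
    ext i j
    have h1 : HasDerivAt (fun s => (tensorPow ι (V s) * X) i j) ((tensorDer ι H * X) i j) 0 := by
      simp only [Matrix.mul_apply]
      exact HasDerivAt.fun_sum fun k _ => (hd i k).mul_const _
    have h2 : HasDerivAt (fun s => (X * tensorPow ι (V s)) i j) ((X * tensorDer ι H) i j) 0 := by
      simp only [Matrix.mul_apply]
      exact HasDerivAt.fun_sum fun k _ => (hd k j).const_mul _
    have h3 : (fun s => (X * tensorPow ι (V s)) i j) = fun s => (tensorPow ι (V s) * X) i j :=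
      funext fun s => by rw [hX _ (hV s)]
    rw [h3] at h2
    exact h1.unique h2
  have hdec : H = (2⁻¹ : ℂ) • (H - star H) + (-(2⁻¹ * Complex.I)) • (Complex.I • (H + star H)) := by
    rw [smul_smul, show -(2⁻¹ * Complex.I) * Complex.I = 2⁻¹ by
      rw [neg_mul, mul_assoc, Complex.I_mul_I]; ring, ← smul_add]
    rw [show H - star H + (H + star H) = (2 : ℂ) • H by rw [two_smul]; abel, smul_smul]
    norm_num
  rw [hdec, tensorDer_add, tensorDer_smul, tensorDer_smul, add_mul, mul_add, smul_mul_assoc,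
    smul_mul_assoc, mul_smul_comm, mul_smul_comm, hskew (H - star H), hskew (Complex.I • _)]
  · simp [star_smul, add_comm]
  · simp

end Tensor

/-! ### Invariance of Haar measure and the moments of a unitary matrix. -/

section Haar

variable {N : ℕ}

/-- The unitary group as a type. -/
abbrev UGroup (N : ℕ) : Type := Matrix.unitaryGroup (Fin N) ℂ

instance unitaryHaar_isProbabilityMeasure : IsProbabilityMeasure (unitaryHaar N) := by
  unfold unitaryHaar
  refine ⟨?_⟩
  exact Measure.haarMeasure_self (K₀ := (⊤ : TopologicalSpace.PositiveCompacts (UGroup N)))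

instance unitaryHaar_isMulLeftInvariant : (unitaryHaar N).IsMulLeftInvariant := by
  unfold unitaryHaar
  infer_instance

theorem continuous_entry (a b : Fin N) : Continuous fun U : UGroup N => (U : Matrix _ _ ℂ) a b :=
  (continuous_apply_apply a b).comp continuous_subtype_val

theorem integrable_of_continuous {f : UGroup N → ℂ} (hf : Continuous f) :
    Integrable f (unitaryHaar N) :=
  hf.integrable_of_hasCompactSupport (HasCompactSupport.of_compactSpace f)

variable {ι : Type} [Fintype ι] [DecidableEq ι]

/-- The moments of the entries of a Haar unitary matrix. -/
def unitaryMoment (i j p q : ι → Fin N) : ℂ :=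
  ∫ U : UGroup N, ∏ k, (U : Matrix _ _ ℂ) (i k) (p k) * star ((U : Matrix _ _ ℂ) (j k) (q k))
    ∂(unitaryHaar N)

omit [DecidableEq ι] in
theorem continuous_moment (i j p q : ι → Fin N) : Continuous fun U : UGroup N =>
    ∏ k, (U : Matrix _ _ ℂ) (i k) (p k) * star ((U : Matrix _ _ ℂ) (j k) (q k)) :=
  continuous_finsetProd _ fun k _ =>
    (continuous_entry (i k) (p k)).mul (continuous_entry (j k) (q k)).star

/-- Substituting VU for U shows that the moments, as a matrix in the row indices (i, j), are
unchanged by conjugation by the tensor power of V. -/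
theorem tensorPow_mul_unitaryMoment (p q : ι → Fin N) (V : Matrix (Fin N) (Fin N) ℂ)
    (hV : V ∈ Matrix.unitaryGroup (Fin N) ℂ) :
    tensorPow ι V * (Matrix.of fun i j => unitaryMoment i j p q) =
      (Matrix.of fun i j => unitaryMoment i j p q) * tensorPow ι V := by
  have key : (Matrix.of fun i j => unitaryMoment i j p q) =
      tensorPow ι V * (Matrix.of fun i j => unitaryMoment i j p q) * tensorPow ι (star V) := by
    ext i j
    have h1 : unitaryMoment i j p q = ∫ U : UGroup N, ∑ j' : ι → Fin N, ∑ i' : ι → Fin N,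
        ((∏ k, V (i k) (i' k)) * ∏ k, star V (j' k) (j k)) *
          ∏ k, (U : Matrix _ _ ℂ) (i' k) (p k) * star ((U : Matrix _ _ ℂ) (j' k) (q k))
        ∂(unitaryHaar N) := by
      unfold unitaryMoment
      rw [← integral_mul_left_eq_self _ (⟨V, hV⟩ : UGroup N)]
      refine integral_congr_ae (Filter.Eventually.of_forall fun U => ?_)
      simp only [Submonoid.coe_mul, Matrix.mul_apply, star_sum, star_mul']
      rw [Finset.prod_mul_distrib, Finset.prod_univ_sum, Finset.prod_univ_sum, mul_comm,
        Finset.sum_mul_sum]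
      simp only [Fintype.piFinset_univ]
      refine Finset.sum_congr rfl fun j' _ => Finset.sum_congr rfl fun i' _ => ?_
      simp only [Finset.prod_mul_distrib, Matrix.star_apply]
      ring
    rw [Matrix.of_apply, h1, integral_finsetSum]
    · rw [Matrix.mul_apply]
      refine Finset.sum_congr rfl fun j' _ => ?_
      rw [integral_finsetSum]
      · rw [Matrix.mul_apply, Finset.sum_mul]
        refine Finset.sum_congr rfl fun i' _ => ?_
        rw [integral_const_mul]
        simp only [tensorPow, Matrix.of_apply]
        unfold unitaryMoment
        ring
      · intro i' _
        exact integrable_of_continuous (continuous_const.mul (continuous_moment i' j' p q))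
    · intro j' _
      refine integrable_of_continuous (continuous_finsetSum _ fun i' _ => ?_)
      exact continuous_const.mul (continuous_moment i' j' p q)
  have h2 : tensorPow ι (star V) * tensorPow ι V = 1 := by
    rw [← tensorPow_mul, Matrix.mem_unitaryGroup_iff'.mp hV, tensorPow_one]
  conv_rhs => rw [key]
  rw [mul_assoc, h2, mul_one]

/-- Infinitesimal left invariance in the direction of the matrix unit E_ab. It is not
skew-Hermitian, so the extension to all complex matrices is needed here. -/
theorem sum_unitaryMoment_update (i j p q : ι → Fin N) (a b : Fin N) :
    ∑ k, (if i k = a then unitaryMoment (Function.update i k b) j p q else 0) =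
      ∑ k, if j k = b then unitaryMoment i (Function.update j k a) p q else 0 := by
  have h := congrFun (congrFun (commute_tensorDer_of_commute_tensorPow _
    (tensorPow_mul_unitaryMoment p q) (Matrix.single a b 1)) i) j
  rw [tensorDer_mul_apply, mul_tensorDer_apply] at h
  simp only [Matrix.single_apply, Matrix.of_apply, ite_mul, one_mul, zero_mul, ite_and] at h
  simpa [eq_comm] using h

end Haar
-- The loop equation and the Weingarten expansion over monotone walks.
section Weingarten

variable {N : ℕ}

theorem unitaryMoment_comp_right {ι : Type} [Fintype ι] [DecidableEq ι] (i j p q : ι → Fin N)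
    (π : Perm ι) : unitaryMoment i (j ∘ π) p (q ∘ π) = unitaryMoment i j p q := by
  unfold unitaryMoment
  refine integral_congr_ae (Filter.Eventually.of_forall fun U => ?_)
  simp only [Finset.prod_mul_distrib]
  congr 1
  exact Equiv.prod_comp π fun k => star ((U : Matrix (Fin N) (Fin N) ℂ) (j k) (q k))

theorem sum_unitary_mul_star (U : UGroup N) (p q : Fin N) :
    ∑ a, (U : Matrix (Fin N) (Fin N) ℂ) a p * star ((U : Matrix (Fin N) (Fin N) ℂ) a q) = if p = q then 1 else 0 := by
  have h := congrFun (congrFun (Matrix.mem_unitaryGroup_iff'.mp U.2) q) p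
  rw [Matrix.mul_apply, Matrix.one_apply] at h
  simp only [Matrix.star_apply] at h
  refine Eq.trans (Finset.sum_congr rfl fun a _ => mul_comm _ _) (h.trans ?_)
  simp [eq_comm]

/-- Orthonormality of the columns of U contracts the last pair of factors; this is what lowers the
degree in the loop equation. -/
theorem sum_unitaryMoment_last {d : ℕ} (i j p q : Fin (d + 1) → Fin N) :
    ∑ a, unitaryMoment (Function.update i (Fin.last d) a) (Function.update j (Fin.last d) a) p q =
      if p (Fin.last d) = q (Fin.last d) then
        unitaryMoment (Fin.init i) (Fin.init j) (Fin.init p) (Fin.init q) else 0 := by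
  unfold unitaryMoment
  rw [← integral_finsetSum _ fun a _ => integrable_of_continuous (continuous_moment _ _ p q)]
  have h : ∀ U : UGroup N, ∑ a, ∏ k,
      (U : Matrix (Fin N) (Fin N) ℂ) (Function.update i (Fin.last d) a k) (p k) *
        star ((U : Matrix (Fin N) (Fin N) ℂ) (Function.update j (Fin.last d) a k) (q k)) =
      (∏ k, (U : Matrix (Fin N) (Fin N) ℂ) (Fin.init i k) (Fin.init p k) *
        star ((U : Matrix (Fin N) (Fin N) ℂ) (Fin.init j k) (Fin.init q k))) *
      if p (Fin.last d) = q (Fin.last d) then 1 else 0 := by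
    intro U
    rw [← sum_unitary_mul_star U, Finset.mul_sum]
    refine Finset.sum_congr rfl fun a _ => ?_
    rw [Fin.prod_univ_castSucc]
    simp [Fin.init, Fin.castSucc_ne_last]
  simp_rw [h, integral_mul_const]
  split_ifs <;> simp

/-- The loop equation for unitary moments. -/
theorem unitaryMoment_recursion {d : ℕ} (i j p q : Fin (d + 1) → Fin N) :
    (N : ℂ) * unitaryMoment i j p q +
      ∑ s : Fin d, unitaryMoment (i ∘ swap s.castSucc (Fin.last d)) j p q =
    ∑ k : Fin (d + 1), if i (Fin.last d) = j k ∧ p (Fin.last d) = q k then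
      unitaryMoment (Fin.init i) (Fin.init (j ∘ swap k (Fin.last d))) (Fin.init p)
        (Fin.init (q ∘ swap k (Fin.last d))) else 0 := by
  -- Put `a` in the last slot of `i`, move it back to `i (Fin.last d)`, and sum over `a`. On the
  -- left the last slot contributes N copies of the moment, and any other slot s forces a = i s,
  -- producing the swap of s with the last point. On the right, `a` is left in a matched pair of
  -- slots, ready to be contracted.
  have h := Finset.sum_congr (s₁ := (Finset.univ : Finset (Fin N))) rfl fun a _ =>
    sum_unitaryMoment_update (Function.update i (Fin.last d) a) j p q a (i (Fin.last d))
  rw [Finset.sum_comm, Finset.sum_comm (s := Finset.univ) (t := Finset.univ (α := Fin (d + 1)))] at h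
  rw [Fin.sum_univ_castSucc] at h
  rw [add_comm]
  refine Eq.trans ?_ (h.trans ?_)
  · congr 1
    · refine Finset.sum_congr rfl fun s _ => ?_
      simp only [Function.update_of_ne (Fin.castSucc_ne_last s)]
      rw [Finset.sum_ite_eq]
      simp only [Finset.mem_univ, if_true]
      congr 1
      funext l
      by_cases h1 : l = s.castSucc
      · subst h1; simp
      · by_cases h2 : l = Fin.last d
        · subst h2; simp [h1]
        · simp [h1, h2, swap_apply_of_ne_of_ne h1 h2]
    · simp
  · refine Finset.sum_congr rfl fun k _ => ?_
    by_cases h1 : j k = i (Fin.last d)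
    · simp only [h1, if_true, true_and]
      have h2 : ∀ a, unitaryMoment (Function.update i (Fin.last d) a) (Function.update j k a) p q =
          unitaryMoment (Function.update i (Fin.last d) a)
            (Function.update (j ∘ swap k (Fin.last d)) (Fin.last d) a) p
            (q ∘ swap k (Fin.last d)) := by
        intro a
        rw [← unitaryMoment_comp_right _ (Function.update j k a) _ _ (swap k (Fin.last d))]
        congr 1
        funext l
        rcases eq_or_ne l (Fin.last d) with rfl | h3
        · simp
        · rcases eq_or_ne l k with rfl | h4
          · simp [h3, h3.symm]
          · simp [h3, h4, swap_apply_of_ne_of_ne h4 h3]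
      simp_rw [h2, sum_unitaryMoment_last]
      simp
    · simp [h1, Ne.symm h1]

/-- The Neumann series: the sum over words inverts g ↦ g - y ∑ g(s :: ·) at the empty word, because
the terms of length n + 1 telescope against those subtracted at length n. -/
theorem tsum_list_sub_cons {κ : Type} [Fintype κ] [LinearOrder κ] (y : ℂ)
    (hy : Fintype.card κ * ‖y‖ < 1) (g : List κ → ℂ) (C : ℝ) (hg : ∀ l, ‖g l‖ ≤ C) :
    ∑' l : List κ, y ^ l.length * (g l - y * ∑ s, g (s :: l)) = g [] := by
  have hs : Summable fun l : List κ => y ^ l.length * g l := by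
    refine Summable.of_norm_bounded (g := fun l => ‖y‖ ^ l.length * C)
      ((summable_pow_length ‖y‖ (norm_nonneg y) hy).mul_right C) fun l => ?_
    rw [norm_mul, norm_pow]
    exact mul_le_mul_of_nonneg_left (hg l) (by positivity)
  have hinj : Function.Injective fun x : List κ × κ => x.2 :: x.1 := by
    rintro ⟨a, b⟩ ⟨c, d⟩ h
    simp only [List.cons.injEq] at h
    simp [h.1, h.2]
  have hs2 : Summable fun x : List κ × κ => y ^ (x.1.length + 1) * g (x.2 :: x.1) :=
    (hs.comp_injective hinj).congr fun x => by simp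
  have h1 : ∑' l : List κ, y ^ l.length * g l =
      g [] + ∑' l : List κ, ∑ s, y ^ (l.length + 1) * g (s :: l) := by
    rw [hs.tsum_eq_add_tsum_ite []]
    congr 1
    · simp
    · have := hs2.tsum_prod' fun l => Summable.of_finite
      simp only [tsum_fintype] at this
      rw [← this]
      refine (hinj.tsum_eq ?_).symm.trans (tsum_congr fun x => ?_)
      · intro l hl
        cases l with
        | nil => simp at hl
        | cons s l => exact ⟨(l, s), rfl⟩
      · simp
  have hs3 : Summable fun l : List κ => ∑ s, y ^ (l.length + 1) * g (s :: l) := by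
    have := hs2.prod
    simpa only [tsum_fintype] using this
  have h2 : ∀ l : List κ, y ^ l.length * (g l - y * ∑ s, g (s :: l)) =
      y ^ l.length * g l - ∑ s, y ^ (l.length + 1) * g (s :: l) := by
    intro l
    rw [← Finset.mul_sum]
    ring
  simp_rw [h2]
  rw [hs.tsum_sub hs3, h1]
  ring

/-- The number of permutations matching both pairs of index tuples. -/
def matchings {d : ℕ} (i j p q : Fin d → Fin N) : ℂ :=
  ∑ σ : Perm (Fin d), if i = j ∘ σ ∧ p = q ∘ σ then 1 else 0

/-- Extension of a permutation of `Fin d` fixing the last point of `Fin (d + 1)`. -/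
def extPerm {d : ℕ} (π : Perm (Fin d)) : Perm (Fin (d + 1)) :=
  mergePerm (finSumFinEquiv (m := d) (n := 1)) (π, 1)

@[simp] theorem extPerm_castSucc {d : ℕ} (π : Perm (Fin d)) (b : Fin d) :
    extPerm π b.castSucc = (π b).castSucc :=
  mergePerm_inl (finSumFinEquiv (m := d) (n := 1)) (π, 1) b

@[simp] theorem extPerm_last {d : ℕ} (π : Perm (Fin d)) :
    extPerm π (Fin.last d) = Fin.last d :=
  mergePerm_inr (finSumFinEquiv (m := d) (n := 1)) (π, 1) 0

theorem extPerm_inv {d : ℕ} (π : Perm (Fin d)) : (extPerm π)⁻¹ = extPerm π⁻¹ := by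
  rw [extPerm, extPerm, ← map_inv]
  simp

theorem stepPerm_castSucc {d : ℕ} (t : Fin d) (l : List (Fin d)) :
    stepPerm t.castSucc (l.map Fin.castSucc) = extPerm (stepPerm t l) :=
  stepPerm_merge_inl (finSumFinEquiv (m := d) (n := 1)) t l

/-- The transpositions (k, last), including the trivial one, represent the cosets of S(d) in S(d +
1). -/
theorem bijective_swap_mul_extPerm (d : ℕ) : Function.Bijective
    fun x : Fin (d + 1) × Perm (Fin d) => swap x.1 (Fin.last d) * extPerm x.2 := by
  rw [Fintype.bijective_iff_injective_and_card]
  constructor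
  · rintro ⟨k, π⟩ ⟨k', π'⟩ h
    have h1 := congrArg (fun f : Perm (Fin (d + 1)) => f (Fin.last d)) h
    simp only [Perm.mul_apply, extPerm_last, swap_apply_right] at h1
    subst h1
    have h2 := mergePerm_injective _ (mul_left_cancel h)
    simpa using h2
  · simp [Fintype.card_perm, Nat.factorial_succ]

/-- Splitting σ along these cosets yields the same sum as the right side of
`unitaryMoment_recursion`. -/
theorem matchings_succ {d : ℕ} (i j p q : Fin (d + 1) → Fin N) :
    matchings i j p q = ∑ k : Fin (d + 1), if i (Fin.last d) = j k ∧ p (Fin.last d) = q k then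
      matchings (Fin.init i) (Fin.init (j ∘ swap k (Fin.last d))) (Fin.init p)
        (Fin.init (q ∘ swap k (Fin.last d))) else 0 := by
  have key : ∀ (i j : Fin (d + 1) → Fin N) (k : Fin (d + 1)) (π : Perm (Fin d)),
      i = j ∘ (swap k (Fin.last d) * extPerm π : Perm _) ↔ i (Fin.last d) = j k ∧
        Fin.init i = Fin.init (j ∘ swap k (Fin.last d)) ∘ π := by
    intro i j k π
    rw [funext_iff, Fin.forall_fin_succ', funext_iff, and_comm]
    simp [Fin.init]
  unfold matchings
  rw [← (Equiv.ofBijective _ (bijective_swap_mul_extPerm d)).sum_comp, Fintype.sum_prod_type]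
  refine Finset.sum_congr rfl fun k _ => ?_
  simp only [Equiv.ofBijective_apply, key]
  by_cases h1 : i (Fin.last d) = j k <;> by_cases h2 : p (Fin.last d) = q k <;> simp [h1, h2]

/-- Extension of a walk on `Fin d` by a list of predecessors of the last point. -/
def extWalk {d : ℕ} (x : List (Fin d) × (Fin d → List (Fin d))) :
    Fin (d + 1) → List (Fin (d + 1)) :=
  Fin.snoc (α := fun _ => List (Fin (d + 1))) (fun t => (x.2 t).map Fin.castSucc)
    (x.1.map Fin.castSucc)

theorem extWalk_injective (d : ℕ) : Function.Injective (extWalk (d := d)) := by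
  have hm : Function.Injective (List.map (Fin.castSucc (n := d))) :=
    List.map_injective_iff.mpr (Fin.castSucc_injective d)
  rintro ⟨l, L⟩ ⟨l', L'⟩ h
  simp only [extWalk, Fin.snoc_inj] at h
  refine Prod.ext (hm h.2) (funext fun t => hm (congrFun h.1 t))

theorem validWalk_extWalk {d : ℕ} (x : List (Fin d) × (Fin d → List (Fin d))) :
    ValidWalk (extWalk x) ↔ ValidWalk x.2 := by
  unfold ValidWalk extWalk
  rw [Fin.forall_fin_succ']
  simp [Fin.castSucc_lt_last]

theorem walkLength_extWalk {d : ℕ} (x : List (Fin d) × (Fin d → List (Fin d))) :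
    walkLength (extWalk x) = x.1.length + walkLength x.2 := by
  simp [walkLength, extWalk, Fin.sum_univ_castSucc, add_comm]

/-- The new point is the largest, so in the monotone order its transpositions form the final block.
-/
theorem walkPerm_extWalk {d : ℕ} (x : List (Fin d) × (Fin d → List (Fin d))) :
    walkPerm (extWalk x) = extPerm (walkPerm x.2) *
      stepPerm (Fin.last d) (x.1.map Fin.castSucc) := by
  have hsort : (Finset.univ.sort (α := Fin (d + 1)) (· ≤ ·)) =
      (Finset.univ.sort (α := Fin d) (· ≤ ·)).map Fin.castSucc ++ [Fin.last d] := by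
    refine sort_univ_eq ?_ ?_
    · rw [List.pairwise_append]
      refine ⟨?_, by simp, ?_⟩
      · rw [List.pairwise_map]
        exact (Finset.sortedLT_sort _).pairwise
      · intro a ha b hb
        obtain ⟨c, _, rfl⟩ := List.mem_map.mp ha
        rw [List.mem_singleton.mp hb]
        exact Fin.castSucc_lt_last c
    · intro a
      induction a using Fin.lastCases with
      | last => simp
      | cast b => simp
  have hext : ∀ l : List (Perm (Fin d)), extPerm l.prod = (l.map extPerm).prod := by
    intro l
    induction l with
    | nil => simp only [List.prod_nil, List.map_nil]; exact map_one (mergePerm _)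
    | cons a l ih =>
      rw [List.prod_cons, List.map_cons, List.prod_cons, ← ih]
      simp only [extPerm, ← map_mul]
      simp
  unfold walkPerm
  rw [hsort, List.map_append, List.prod_append, hext, List.map_map, List.map_map]
  congr 1
  · congr 1
    refine List.map_congr_left fun t _ => ?_
    simp [extWalk, stepPerm_castSucc]
  · simp [extWalk]

theorem mem_range_extWalk {d : ℕ} {L : Fin (d + 1) → List (Fin (d + 1))} (h : ValidWalk L) :
    L ∈ Set.range extWalk := by
  have h1 : ∀ t, ∃ l : List (Fin d), l.map Fin.castSucc = L t := by
    intro t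
    have : ∀ s ∈ L t, s ∈ Set.range (Fin.castSucc (n := d)) := by
      intro s hs
      have := (h t s hs).trans_le (Fin.le_last t)
      exact ⟨s.castPred this.ne, by simp⟩
    exact (Set.range_list_map _).ge this
  choose l hl using h1
  refine ⟨(l (Fin.last d), fun t => l t.castSucc), ?_⟩
  funext t
  induction t using Fin.lastCases with
  | last => simp [extWalk, hl]
  | cast t => simp [extWalk, hl]

open Classical in
/-- The weight of a walk. -/
def walkWeight {d : ℕ} (y : ℂ) (L : Fin d → List (Fin d)) : ℂ :=
  if ValidWalk L then y ^ walkLength L else 0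

theorem summable_norm_walkWeight {d : ℕ} (y : ℂ) (h : d * ‖y‖ < 1) :
    Summable fun L : Fin d → List (Fin d) => ‖walkWeight y L‖ := by
  refine (summable_pow_walkLength (α := Fin d) ‖y‖ (norm_nonneg y) (by simpa using h)).of_nonneg_of_le
    (fun _ => norm_nonneg _) fun L => ?_
  unfold walkWeight
  split_ifs
  · rw [norm_pow]
  · simp

theorem summable_walkWeight_mul {d : ℕ} (y : ℂ) (h : d * ‖y‖ < 1) {X : Type} [Finite X]
    (f : X → ℂ) (x : (Fin d → List (Fin d)) → X) :
    Summable fun L : Fin d → List (Fin d) => walkWeight y L * f (x L) := by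
  obtain ⟨C, hC⟩ := (Set.finite_range fun z => ‖f z‖).bddAbove
  refine Summable.of_norm_bounded (g := fun L => ‖walkWeight y L‖ * C)
    ((summable_norm_walkWeight y h).mul_right C) fun L => ?_
  rw [norm_mul]
  exact mul_le_mul_of_nonneg_left (hC ⟨x L, rfl⟩) (norm_nonneg _)

/-- The Weingarten expansion of unitary moments as a sum over monotone walks. -/
theorem unitaryMoment_eq_tsum (d : ℕ) (hd : d ≤ N) (i j p q : Fin d → Fin N) :
    (N : ℂ) ^ d * unitaryMoment i j p q =
      ∑' L : Fin d → List (Fin d), walkWeight (-(N : ℂ)⁻¹) L *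
        matchings (i ∘ ((walkPerm L)⁻¹ : Perm _)) j p q := by
  induction d with
  | zero =>
    rw [tsum_eq_single fun _ => []]
    · have : ValidWalk (fun _ => [] : Fin 0 → List (Fin 0)) := fun t => t.elim0
      have h1 : ∀ i : Fin 0 → Fin N, matchings i j p q = 1 := by
        intro i
        unfold matchings
        rw [Fintype.sum_unique, if_pos ⟨Subsingleton.elim _ _, Subsingleton.elim _ _⟩]
      rw [h1]
      simp [unitaryMoment, walkWeight, this, walkLength]
    · intro L hL
      exact absurd (Subsingleton.elim _ _) hL
  | succ d ih =>
    have hN0 : (N : ℂ) ≠ 0 := by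
      have : N ≠ 0 := by omega
      exact_mod_cast this
    have hNpos : (0 : ℝ) < N := by exact_mod_cast (by omega : 0 < N)
    set y : ℂ := -(N : ℂ)⁻¹ with hy
    have hyn : ‖y‖ = (N : ℝ)⁻¹ := by simp [hy]
    -- Predecessors of the last of the d + 1 points lie in `Fin d`, so the ratio is d / N, and d + 1
    -- ≤ N suffices for convergence.
    have hdy : (d : ℝ) * ‖y‖ < 1 := by
      rw [hyn, ← div_eq_mul_inv, div_lt_one hNpos]
      exact_mod_cast (by omega : d < N)
    have hrec : ∀ i : Fin (d + 1) → Fin N, (N : ℂ) ^ d * ((N : ℂ) * unitaryMoment i j p q +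
        ∑ s : Fin d, unitaryMoment (i ∘ swap s.castSucc (Fin.last d)) j p q) =
        ∑' L : Fin d → List (Fin d), walkWeight y L *
          matchings (i ∘ ((extPerm (walkPerm L))⁻¹ : Perm _)) j p q := by
      intro i
      rw [unitaryMoment_recursion, Finset.mul_sum]
      have h1 : ∀ L : Fin d → List (Fin d), walkWeight y L *
          matchings (i ∘ ((extPerm (walkPerm L))⁻¹ : Perm _)) j p q = ∑ k : Fin (d + 1),
          if i (Fin.last d) = j k ∧ p (Fin.last d) = q k then walkWeight y L *
            matchings (Fin.init i ∘ ((walkPerm L)⁻¹ : Perm _))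
              (Fin.init (j ∘ swap k (Fin.last d))) (Fin.init p)
              (Fin.init (q ∘ swap k (Fin.last d))) else 0 := by
        intro L
        rw [matchings_succ, Finset.mul_sum]
        refine Finset.sum_congr rfl fun k _ => ?_
        rw [extPerm_inv]
        have h2 : Fin.init (i ∘ (extPerm (walkPerm L)⁻¹ : Perm _)) =
            Fin.init i ∘ ((walkPerm L)⁻¹ : Perm _) := by
          funext t
          simp [Fin.init, -Perm.coe_inv]
        rw [h2, mul_ite, mul_zero]
        simp [-Perm.coe_inv]
      simp_rw [h1]
      rw [Summable.tsum_finsetSum]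
      · refine Finset.sum_congr rfl fun k _ => ?_
        split_ifs
        · exact ih (by omega) _ _ _ _
        · simp
      · intro k _
        split_ifs
        · exact summable_walkWeight_mul y hdy (fun π : Perm (Fin d) =>
            matchings (Fin.init i ∘ (π⁻¹ : Perm _))
              (Fin.init (j ∘ swap k (Fin.last d))) (Fin.init p)
              (Fin.init (q ∘ swap k (Fin.last d)))) walkPerm
        · exact summable_zero
    obtain ⟨C, hC⟩ := (Set.finite_range fun i : Fin (d + 1) → Fin N =>
      ‖unitaryMoment i j p q‖).bddAbove
    let w : List (Fin d) → Perm (Fin (d + 1)) := fun l =>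
      stepPerm (Fin.last d) (l.map Fin.castSucc)
    have hw : ∀ s l, w (s :: l) = swap s.castSucc (Fin.last d) * w l := by
      intro s l
      simp [w, stepPerm]
    -- With y = -1/N the left side of the loop equation is N times g - y ∑ g(s :: ·), for g(l) the
    -- moment with `i` permuted by the word `l` in the transpositions (s, last).
    have hinv := tsum_list_sub_cons y (by simpa using hdy)
      (fun l => unitaryMoment (i ∘ ((w l)⁻¹ : Perm _)) j p q) C fun l => hC ⟨_, rfl⟩
    have hw0 : i ∘ ((w [])⁻¹ : Perm _) = i := by
      simp [w, stepPerm]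
    rw [hw0] at hinv
    have hterm : ∀ l : List (Fin d), (N : ℂ) ^ (d + 1) * (y ^ l.length *
        (unitaryMoment (i ∘ ((w l)⁻¹ : Perm _)) j p q -
          y * ∑ s, unitaryMoment (i ∘ ((w (s :: l))⁻¹ : Perm _)) j p q)) =
        ∑' L : Fin d → List (Fin d), y ^ l.length * (walkWeight y L *
          matchings (i ∘ ((extPerm (walkPerm L) * w l)⁻¹ : Perm _)) j p q) := by
      intro l
      rw [tsum_mul_left]
      have h1 := hrec (i ∘ ((w l)⁻¹ : Perm _))
      have h2 : ∀ L : Fin d → List (Fin d), i ∘ ((extPerm (walkPerm L) * w l)⁻¹ : Perm _) =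
          (i ∘ ((w l)⁻¹ : Perm _)) ∘ ((extPerm (walkPerm L))⁻¹ : Perm _) := by
        intro L
        rw [mul_inv_rev]
        rfl
      have h3 : ∀ s, i ∘ ((w (s :: l))⁻¹ : Perm _) =
          (i ∘ ((w l)⁻¹ : Perm _)) ∘ swap s.castSucc (Fin.last d) := by
        intro s
        rw [hw, mul_inv_rev, swap_inv]
        rfl
      simp_rw [h2, h3]
      rw [← h1, hy]
      field_simp
      ring
    rw [← hinv, ← tsum_mul_left]
    simp_rw [hterm]
    have hs : Summable fun x : List (Fin d) × (Fin d → List (Fin d)) =>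
        y ^ x.1.length * (walkWeight y x.2 *
          matchings (i ∘ ((extPerm (walkPerm x.2) * w x.1)⁻¹ : Perm _)) j p q) := by
      obtain ⟨C', hC'⟩ := (Set.finite_range fun i : Fin (d + 1) → Fin N =>
        ‖matchings i j p q‖).bddAbove
      have h1 := (summable_pow_length (α := Fin d) ‖y‖ (norm_nonneg y)
        (by simpa using hdy)).mul_of_nonneg (summable_norm_walkWeight (d := d) y hdy)
        (fun l => by simp only [Pi.zero_apply]; positivity) (fun _ => norm_nonneg _)
      refine Summable.of_norm_bounded (h1.mul_right C') fun x => ?_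
      rw [norm_mul, norm_mul, norm_pow, ← mul_assoc]
      exact mul_le_mul_of_nonneg_left (hC' ⟨_, rfl⟩) (by positivity)
    -- The word at the last point and the walk on `Fin d` from the induction hypothesis together
    -- form a walk on `Fin (d + 1)`; the invalid walks carry weight zero.
    rw [← hs.tsum_prod, ← (extWalk_injective d).tsum_eq]
    · refine tsum_congr fun x => ?_
      rw [walkPerm_extWalk, ← mul_assoc]
      congr 1
      by_cases hv : ValidWalk x.2
      · have hv' := (validWalk_extWalk x).mpr hv
        simp [walkWeight, hv, hv', walkLength_extWalk, pow_add]
      · have hv' : ¬ValidWalk (extWalk x) := fun h => hv ((validWalk_extWalk x).mp h)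
        simp [walkWeight, hv, hv']
    · intro L hL
      refine mem_range_extWalk ?_
      by_contra hn
      simp [walkWeight, hn] at hL

end Weingarten
-- Moments of Tr(AUBU⁻¹) as sums over factorizations.
section TraceMoments

variable {N : ℕ} (A B : Matrix (Fin N) (Fin N) ℂ)

/-- The trace `Tr(A U B U⁻¹)`. -/
def orbitTrace (U : UGroup N) : ℂ :=
  Matrix.trace (A * (U : Matrix (Fin N) (Fin N) ℂ) * B *
    ((U⁻¹ : UGroup N) : Matrix (Fin N) (Fin N) ℂ))

theorem orbitTrace_eq_sum (U : UGroup N) :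
    orbitTrace A B U = ∑ x : Fin N × Fin N × Fin N × Fin N,
      A x.1 x.2.1 * B x.2.2.1 x.2.2.2 * ((U : Matrix (Fin N) (Fin N) ℂ) x.2.1 x.2.2.1 *
        star ((U : Matrix (Fin N) (Fin N) ℂ) x.1 x.2.2.2)) := by
  unfold orbitTrace Matrix.trace
  simp only [Fintype.sum_prod_type, Matrix.diag_apply, Matrix.mul_apply, Finset.sum_mul]
  refine Finset.sum_congr rfl fun j _ => ?_
  rw [Finset.sum_comm]
  rw [Finset.sum_congr rfl fun p _ => Finset.sum_comm, Finset.sum_comm]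
  refine Finset.sum_congr rfl fun i _ => ?_
  refine Finset.sum_congr rfl fun p _ => ?_
  refine Finset.sum_congr rfl fun q _ => ?_
  rw [show ((U⁻¹ : UGroup N) : Matrix (Fin N) (Fin N) ℂ) = star (U : Matrix (Fin N) (Fin N) ℂ)
    from rfl, Matrix.star_apply]
  ring

theorem continuous_orbitTrace : Continuous (orbitTrace A B) := by
  rw [funext (orbitTrace_eq_sum A B)]
  apply continuous_finsetSum
  intro x _
  apply continuous_const.mul
  exact (continuous_entry _ _).mul (continuous_entry _ _).star

/-- Tuples of quadruples are quadruples of tuples. -/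
def arrowQuadEquiv (ι X : Type) :
    (ι → X × X × X × X) ≃ (ι → X) × (ι → X) × (ι → X) × (ι → X) where
  toFun f := (fun k => (f k).1, fun k => (f k).2.1, fun k => (f k).2.2.1, fun k => (f k).2.2.2)
  invFun f k := (f.1 k, f.2.1 k, f.2.2.1 k, f.2.2.2 k)
  left_inv _ := rfl
  right_inv _ := rfl

theorem integral_orbitTrace_pow_eq_sum (d : ℕ) :
    ∫ U, orbitTrace A B U ^ d ∂(unitaryHaar N) =
      ∑ j : Fin d → Fin N, ∑ i : Fin d → Fin N, ∑ p : Fin d → Fin N, ∑ q : Fin d → Fin N,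
        (∏ k, A (j k) (i k)) * (∏ k, B (p k) (q k)) * unitaryMoment i j p q := by
  simp_rw [orbitTrace_eq_sum, Fintype.sum_pow]
  rw [integral_finsetSum, ← (arrowQuadEquiv (Fin d) (Fin N)).symm.sum_comp]
  · simp only [Fintype.sum_prod_type]
    congr! 8 with j _ i _ p _ q _
    simp only [arrowQuadEquiv, Equiv.coe_fn_symm_mk]
    unfold unitaryMoment
    rw [← integral_const_mul]
    refine integral_congr_ae (Filter.Eventually.of_forall fun U => ?_)
    simp only [Finset.prod_mul_distrib]
  · intro x _
    apply integrable_of_continuous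
    apply continuous_finsetProd
    intro k _
    apply continuous_const.mul
    exact (continuous_entry _ _).mul (continuous_entry _ _).star

/-- Each matching σ identifies indices and closes the entries of A and B into cycles. The
permutation left on the A side is ρ = (σ w)⁻¹, that is, the solution of ρ σ w = 1. -/
theorem sum_mul_matchings (d : ℕ) (w : Perm (Fin d)) :
    ∑ j : Fin d → Fin N, ∑ i : Fin d → Fin N, ∑ p : Fin d → Fin N, ∑ q : Fin d → Fin N,
        (∏ k, A (j k) (i k)) * (∏ k, B (p k) (q k)) * matchings (i ∘ (w⁻¹ : Perm _)) j p q =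
      ∑ σ : Perm (Fin d), cycTrace A (σ * w)⁻¹ * cycTrace B σ := by
  have h1 : ∀ j i p q : Fin d → Fin N,
      (∏ k, A (j k) (i k)) * (∏ k, B (p k) (q k)) * matchings (i ∘ (w⁻¹ : Perm _)) j p q =
      ∑ σ : Perm (Fin d), (if i = j ∘ (σ * w : Perm _) then ∏ k, A (j k) (i k) else 0) *
        if p = q ∘ σ then ∏ k, B (p k) (q k) else 0 := by
    intro j i p q
    rw [matchings, Finset.mul_sum]
    refine Finset.sum_congr rfl fun σ _ => ?_
    have : i ∘ (w⁻¹ : Perm _) = j ∘ σ ↔ i = j ∘ (σ * w : Perm _) := by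
      constructor
      · intro h
        rw [Perm.coe_mul, ← Function.comp_assoc, ← h, Function.comp_assoc, ← Perm.coe_mul]
        simp
      · intro h
        rw [h, Function.comp_assoc, ← Perm.coe_mul]
        simp
    rw [ite_zero_mul_ite_zero, if_congr (and_congr this Iff.rfl) rfl rfl, mul_ite, mul_one,
      mul_zero]
  have h2 : ∀ σ : Perm (Fin d), ∑ j : Fin d → Fin N, ∑ i : Fin d → Fin N,
      (if i = j ∘ (σ * w : Perm _) then ∏ k, A (j k) (i k) else 0) = cycTrace A (σ * w)⁻¹ := by
    intro σ
    unfold cycTrace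
    refine Finset.sum_congr rfl fun j _ => ?_
    rw [Finset.sum_ite_eq' Finset.univ (j ∘ (σ * w : Perm _)) fun i => ∏ k, A (j k) (i k)]
    simp only [Finset.mem_univ, if_true]
    generalize σ * w = π
    rw [← Equiv.prod_comp π⁻¹]
    simp
  have h3 : ∀ σ : Perm (Fin d), ∑ p : Fin d → Fin N, ∑ q : Fin d → Fin N,
      (if p = q ∘ σ then ∏ k, B (p k) (q k) else 0) = cycTrace B σ := by
    intro σ
    unfold cycTrace
    rw [Finset.sum_comm]
    refine Finset.sum_congr rfl fun q _ => ?_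
    rw [Finset.sum_ite_eq' Finset.univ (q ∘ σ) fun p => ∏ k, B (p k) (q k)]
    simp
  simp_rw [h1, ← h2, ← h3]
  simp only [← Fintype.sum_prod_type', Finset.sum_mul_sum]
  simp only [Fintype.sum_prod_type]
  simp_rw [Finset.sum_comm (s := (Finset.univ : Finset (Fin d → Fin N)))
    (t := (Finset.univ : Finset (Perm (Fin d))))]

theorem integral_orbitTrace_pow (d : ℕ) (hd : d < N) :
    (N : ℂ) ^ d * ∫ U, orbitTrace A B U ^ d ∂(unitaryHaar N) =
      partitionFn A B (-(N : ℂ)⁻¹) d := by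
  have hNpos : (0 : ℝ) < N := by exact_mod_cast (by omega : 0 < N)
  set y : ℂ := -(N : ℂ)⁻¹ with hy
  have hyn : ‖y‖ = (N : ℝ)⁻¹ := by simp [hy]
  have hdy : (d : ℝ) * ‖y‖ < 1 := by
    rw [hyn, ← div_eq_mul_inv, div_lt_one hNpos]
    exact_mod_cast hd
  have hdy' : Fintype.card (Fin d) * ‖y‖ < 1 := by simpa using hdy
  have hs := (summable_norm_indicator_weight A B y hdy' {T : Datum (Fin d) | IsConfig T}).of_norm
  have hL : partitionFn A B y d = ∑' L : Fin d → List (Fin d), walkWeight y L *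
      ∑ σ : Perm (Fin d), cycTrace A (σ * walkPerm L)⁻¹ * cycTrace B σ := by
    unfold partitionFn configSum
    rw [Set.inter_univ]
    let E := (Equiv.prodComm (Fin d → List (Fin d)) (Perm (Fin d) × Perm (Fin d))).trans
      (Equiv.prodAssoc (Perm (Fin d)) (Perm (Fin d)) (Fin d → List (Fin d)))
    have hE : ∀ x, E x = (x.2.1, x.2.2, x.1) := fun _ => rfl
    have hs' := hs.comp_injective E.injective
    simp only [Function.comp_def, hE] at hs'
    rw [← E.tsum_eq]
    simp only [hE]
    rw [Summable.tsum_prod' hs' fun L => Summable.of_finite]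
    congr 1
    funext L
    rw [tsum_fintype, Fintype.sum_prod_type_right, Finset.mul_sum]
    congr 1
    funext σ
    -- Once σ and the walk are fixed, the factorization equation determines ρ.
    rw [Finset.sum_eq_single (σ * walkPerm L)⁻¹]
    · classical
      have h1 : IsConfig (((σ * walkPerm L)⁻¹, σ, L) : Datum (Fin d)) ↔ ValidWalk L := by
        unfold IsConfig
        simp only [mul_assoc, inv_mul_cancel, and_true]
      simp only [Set.indicator_apply, Set.mem_ofPred_eq, h1, walkWeight, weight]
      split_ifs
      · ring
      · simp
    · intro ρ _ hρ
      rw [Set.indicator_of_notMem]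
      rintro ⟨_, h⟩
      apply hρ
      rw [mul_assoc] at h
      exact eq_inv_of_mul_eq_one_left h
    · simp
  rw [hL, integral_orbitTrace_pow_eq_sum]
  simp_rw [← sum_mul_matchings A B d, Finset.mul_sum]
  have hterm : ∀ i j p q : Fin d → Fin N,
      (N : ℂ) ^ d * ((∏ k, A (j k) (i k)) * (∏ k, B (p k) (q k)) * unitaryMoment i j p q) =
      ∑' L : Fin d → List (Fin d), walkWeight y L * ((∏ k, A (j k) (i k)) *
        (∏ k, B (p k) (q k)) * matchings (i ∘ ((walkPerm L)⁻¹ : Perm _)) j p q) := by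
    intro i j p q
    rw [mul_left_comm, unitaryMoment_eq_tsum d hd.le, ← tsum_mul_left]
    refine tsum_congr fun L => ?_
    ring
  have hsum : ∀ i j p q : Fin d → Fin N, Summable fun L : Fin d → List (Fin d) =>
      walkWeight y L * ((∏ k, A (j k) (i k)) * (∏ k, B (p k) (q k)) *
        matchings (i ∘ ((walkPerm L)⁻¹ : Perm _)) j p q) := fun i j p q =>
    summable_walkWeight_mul y hdy (fun π : Perm (Fin d) => (∏ k, A (j k) (i k)) *
      (∏ k, B (p k) (q k)) * matchings (i ∘ (π⁻¹ : Perm _)) j p q) walkPerm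
  rw [Summable.tsum_finsetSum fun j _ => summable_sum fun i _ => summable_sum fun p _ =>
    summable_sum fun q _ => hsum i j p q]
  refine Finset.sum_congr rfl fun j _ => ?_
  rw [Summable.tsum_finsetSum fun i _ => summable_sum fun p _ => summable_sum fun q _ => hsum i j p q]
  refine Finset.sum_congr rfl fun i _ => ?_
  rw [Summable.tsum_finsetSum fun p _ => summable_sum fun q _ => hsum i j p q]
  refine Finset.sum_congr rfl fun p _ => ?_
  rw [Summable.tsum_finsetSum fun q _ => hsum i j p q]
  exact Finset.sum_congr rfl fun q _ => hterm i j p q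

end TraceMoments
-- Derivatives and growth of the HCIZ integral.
section Analytic

variable {N : ℕ} (A B : Matrix (Fin N) (Fin N) ℂ)

theorem hcizIntegral_eq (z : ℂ) : hcizIntegral A B z =
    ∫ U, Complex.exp (z * (-(N : ℂ) * orbitTrace A B U)) ∂(unitaryHaar N) := by
  unfold hcizIntegral orbitTrace
  congr 1
  funext U
  congr 1
  ring

/-- `X` is bounded by compactness, so the integrand's derivative is dominated by a constant near
`z`. -/
theorem hasDerivAt_integral_pow_mul_exp (X : UGroup N → ℂ) (hX : Continuous X) (n : ℕ) (z : ℂ) :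
    HasDerivAt (fun z => ∫ U, X U ^ n * Complex.exp (z * X U) ∂(unitaryHaar N))
      (∫ U, X U ^ (n + 1) * Complex.exp (z * X U) ∂(unitaryHaar N)) z := by
  obtain ⟨C, hC⟩ := (isCompact_range hX).isBounded.exists_norm_le
  have hC' : ∀ U, ‖X U‖ ≤ C := fun U => hC _ ⟨U, rfl⟩
  have hC0 : 0 ≤ C := (norm_nonneg _).trans (hC' 1)
  refine (hasDerivAt_integral_of_dominated_loc_of_deriv_le (s := Metric.ball z 1)
    (F := fun z U => X U ^ n * Complex.exp (z * X U))
    (F' := fun z U => X U ^ (n + 1) * Complex.exp (z * X U))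
    (bound := fun _ => C ^ (n + 1) * Real.exp ((‖z‖ + 1) * C)) (Metric.ball_mem_nhds z one_pos)
    (Eventually.of_forall fun w => Continuous.aestronglyMeasurable (by fun_prop))
    (integrable_of_continuous (by fun_prop)) (Continuous.aestronglyMeasurable (by fun_prop))
    (Eventually.of_forall fun U w hw => ?_) (integrable_const _)
    (Eventually.of_forall fun U w hw => ?_)).2
  · rw [norm_mul, norm_pow, Complex.norm_exp]
    have hw' : ‖w‖ ≤ ‖z‖ + 1 := by
      have := norm_sub_norm_le w z
      have h2 := mem_ball_iff_norm.mp hw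
      linarith
    have : (w * X U).re ≤ (‖z‖ + 1) * C := by
      refine (Complex.re_le_norm _).trans ?_
      rw [norm_mul]
      exact mul_le_mul hw' (hC' U) (norm_nonneg _) (by positivity)
    gcongr
    exact hC' U
  · have h := ((hasDerivAt_id w).mul_const (X U)).cexp.const_mul (X U ^ n)
    refine HasDerivAt.congr_deriv (f := fun w => X U ^ n * Complex.exp (w * X U)) h ?_
    simp only [id]
    ring

theorem iteratedDeriv_integral_exp (X : UGroup N → ℂ) (hX : Continuous X) (n : ℕ) :
    iteratedDeriv n (fun z => ∫ U, Complex.exp (z * X U) ∂(unitaryHaar N)) =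
      fun z => ∫ U, X U ^ n * Complex.exp (z * X U) ∂(unitaryHaar N) := by
  induction n with
  | zero => simp
  | succ n ih =>
    rw [iteratedDeriv_succ, ih]
    funext z
    exact (hasDerivAt_integral_pow_mul_exp X hX n z).deriv

theorem continuous_neg_mul_orbitTrace : Continuous fun U => -(N : ℂ) * orbitTrace A B U :=
  continuous_const.mul (continuous_orbitTrace A B)

theorem differentiable_hcizIntegral : Differentiable ℂ (hcizIntegral A B) := by
  intro z
  have h := hasDerivAt_integral_pow_mul_exp _ (continuous_neg_mul_orbitTrace A B) 0 z
  simp only [pow_zero, one_mul] at h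
  rw [funext (hcizIntegral_eq A B)]
  exact h.differentiableAt

theorem iteratedDeriv_hcizIntegral_zero (d : ℕ) (hd : d < N) :
    iteratedDeriv d (hcizIntegral A B) 0 = (-1) ^ d * partitionFn A B (-(N : ℂ)⁻¹) d := by
  rw [funext (hcizIntegral_eq A B),
    iteratedDeriv_integral_exp _ (continuous_neg_mul_orbitTrace A B)]
  simp only [zero_mul, Complex.exp_zero, mul_one, mul_pow]
  rw [integral_const_mul, ← integral_orbitTrace_pow A B d hd, ← mul_assoc, ← mul_pow]
  simp

theorem hcizIntegral_zero : hcizIntegral A B 0 = 1 := by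
  simp [hcizIntegral_eq]

open scoped Matrix.Norms.L2Operator in
theorem norm_orbitTrace_le (M : ℝ) (hM : 0 ≤ M)
    (hA : ‖Matrix.toEuclideanCLM (n := Fin N) (𝕜 := ℂ) A‖ ≤ M)
    (hB : ‖Matrix.toEuclideanCLM (n := Fin N) (𝕜 := ℂ) B‖ ≤ M) (U : UGroup N) :
    ‖orbitTrace A B U‖ ≤ N * M ^ 2 := by
  replace hA : ‖A‖ ≤ M := hA
  replace hB : ‖B‖ ≤ M := hB
  rcases isEmpty_or_nonempty (Fin N) with h0 | h0
  · simp only [orbitTrace, Matrix.trace, Finset.univ_eq_empty, Finset.sum_empty, norm_zero]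
    positivity
  have hU : ∀ V : UGroup N, ‖(V : Matrix (Fin N) (Fin N) ℂ)‖ ≤ 1 := fun V =>
    CStarRing.norm_coe_unitary V |>.le
  have hX : ‖A * (U : Matrix (Fin N) (Fin N) ℂ) * B *
      ((U⁻¹ : UGroup N) : Matrix (Fin N) (Fin N) ℂ)‖ ≤ M ^ 2 := by
    refine (norm_mul_le _ _).trans ?_
    refine (mul_le_mul ((norm_mul_le _ _).trans (mul_le_mul ((norm_mul_le _ _).trans
      (mul_le_mul hA (hU U) (norm_nonneg _) hM)) hB (norm_nonneg _) (by positivity))) (hU U⁻¹)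
      (norm_nonneg _) (by positivity)).trans ?_
    apply le_of_eq
    ring
  have hentry : ∀ (X : Matrix (Fin N) (Fin N) ℂ) k, ‖X k k‖ ≤ ‖X‖ := by
    intro X k
    have h1 := Matrix.l2_opNorm_mulVec X (EuclideanSpace.single k (1 : ℂ))
    rw [PiLp.norm_single, norm_one, mul_one] at h1
    refine le_trans ?_ h1
    have h2 := EuclideanSpace.norm_eq (WithLp.toLp 2 (Matrix.mulVec X
      (EuclideanSpace.single k (1 : ℂ)).ofLp))
    have h3 := PiLp.norm_apply_le (WithLp.toLp 2 (Matrix.mulVec X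
      (EuclideanSpace.single k (1 : ℂ)).ofLp)) k
    simpa using h3
  unfold orbitTrace Matrix.trace
  refine (norm_sum_le _ _).trans ((Finset.sum_le_sum fun k _ => (hentry _ k).trans hX).trans ?_)
  simp

/-- One factor N comes from the exponent and one from the trace. The growth rate N² is that of the
free energy, so Re F_N(z) ≤ M² |z| independently of N. -/
theorem norm_hcizIntegral_le (M : ℝ) (hM : 0 ≤ M)
    (hA : ‖Matrix.toEuclideanCLM (n := Fin N) (𝕜 := ℂ) A‖ ≤ M)
    (hB : ‖Matrix.toEuclideanCLM (n := Fin N) (𝕜 := ℂ) B‖ ≤ M) (z : ℂ) :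
    ‖hcizIntegral A B z‖ ≤ Real.exp ((N : ℝ) ^ 2 * (M ^ 2 * ‖z‖)) := by
  rw [hcizIntegral_eq]
  have h := norm_integral_le_of_norm_le_const (μ := unitaryHaar N)
    (f := fun U => Complex.exp (z * (-(N : ℂ) * orbitTrace A B U)))
    (C := Real.exp ((N : ℝ) ^ 2 * (M ^ 2 * ‖z‖))) (Eventually.of_forall fun U => ?_)
  · simpa using h
  · rw [Complex.norm_exp]
    gcongr
    refine (Complex.re_le_norm _).trans ?_
    rw [norm_mul, norm_mul, norm_neg, Complex.norm_natCast]
    have := norm_orbitTrace_le A B M hM hA hB U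
    calc ‖z‖ * (N * ‖orbitTrace A B U‖) ≤ ‖z‖ * (N * (N * M ^ 2)) := by gcongr
      _ = _ := by ring

end Analytic

/-! ### Logarithms, their Taylor coefficients, and uniform convergence. -/

section FreeEnergy

/-- A nonvanishing holomorphic function on a disc, equal to `1` at the centre, has a logarithm. -/
theorem exists_log_on_ball {f : ℂ → ℂ} {r : ℝ} (hr : 0 < r)
    (hf : DifferentiableOn ℂ f (Metric.ball 0 r)) (h0 : f 0 = 1)
    (hne : ∀ z ∈ Metric.ball 0 r, f z ≠ 0) :
    ∃ G : ℂ → ℂ, DifferentiableOn ℂ G (Metric.ball 0 r) ∧ G 0 = 0 ∧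
      ∀ z ∈ Metric.ball 0 r, f z = Complex.exp (G z) := by
  have hd : DifferentiableOn ℂ (fun z => deriv f z / f z) (Metric.ball 0 r) :=
    (hf.deriv Metric.isOpen_ball).div hf hne
  obtain ⟨G, hG0, hG⟩ := hd.isExactOn_ball.with_val_at 0 0
  refine ⟨G, fun z hz => (hG z hz).differentiableAt.differentiableWithinAt, hG0, ?_⟩
  -- With G a primitive of f'/f, the function f exp(-G) has zero derivative, hence equals its value
  -- 1 at the centre.
  have hq : ∀ z ∈ Metric.ball (0 : ℂ) r,
      HasDerivAt (fun z => f z * Complex.exp (-G z)) 0 z := by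
    intro z hz
    have h1 := (hf.differentiableAt (Metric.isOpen_ball.mem_nhds hz)).hasDerivAt
    have h2 := h1.mul (hG z hz).neg.cexp
    refine HasDerivAt.congr_deriv (f := fun z => f z * Complex.exp (-G z)) h2 ?_
    have := hne z hz
    field_simp
    ring
  intro z hz
  have h1 := (convex_ball (0 : ℂ) r).is_const_of_fderivWithin_eq_zero (𝕜 := ℂ)
    (f := fun z => f z * Complex.exp (-G z))
    (fun w hw => (hq w hw).differentiableAt.differentiableWithinAt) (fun w hw => by
      rw [fderivWithin_of_isOpen Metric.isOpen_ball hw]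
      ext
      simp [(hq w hw).deriv]) hz (Metric.mem_ball_self hr)
  simp only [hG0, h0, neg_zero, Complex.exp_zero, mul_one] at h1
  rw [Complex.exp_neg] at h1
  field_simp at h1
  exact h1

/-- Leibniz's rule applied to f' = G' f; the analytic counterpart of `partitionFn_succ`. -/
theorem iteratedDeriv_succ_of_eq_exp {f G : ℂ → ℂ} {r : ℝ} (hr : 0 < r)
    (hG : DifferentiableOn ℂ G (Metric.ball 0 r))
    (hfG : ∀ z ∈ Metric.ball 0 r, f z = Complex.exp (G z)) (n : ℕ) :
    iteratedDeriv (n + 1) f 0 = ∑ k ∈ Finset.range (n + 1),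
      (n.choose k : ℂ) * iteratedDeriv (k + 1) G 0 * iteratedDeriv (n - k) f 0 := by
  have hmem : (0 : ℂ) ∈ Metric.ball (0 : ℂ) r := Metric.mem_ball_self hr
  have hnhds := Metric.isOpen_ball.mem_nhds hmem
  have hf : DifferentiableOn ℂ f (Metric.ball 0 r) :=
    DifferentiableOn.congr (fun z hz => (hG z hz).cexp) hfG
  have h1 : deriv f =ᶠ[𝓝 0] fun z => deriv G z * f z := by
    filter_upwards [hnhds] with z hz
    have h2 : f =ᶠ[𝓝 z] fun z => Complex.exp (G z) := by
      filter_upwards [Metric.isOpen_ball.mem_nhds hz] with w hw using hfG w hw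
    rw [h2.deriv_eq, hfG z hz]
    have h3 := (hG.differentiableAt (Metric.isOpen_ball.mem_nhds hz)).hasDerivAt.cexp
    rw [h3.deriv, mul_comm]
  rw [iteratedDeriv_succ', h1.iteratedDeriv_eq n, iteratedDeriv_fun_mul]
  · simp only [iteratedDeriv_succ']
  · exact ((hG.deriv Metric.isOpen_ball).contDiffOn Metric.isOpen_ball).contDiffAt hnhds
  · exact (hf.contDiffOn Metric.isOpen_ball).contDiffAt hnhds

/-- Both sides satisfy one recursion, in which the top term k = n has coefficient 1, so it
determines them successively. The moment expansion is available only below degree N, whence the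
bound on n. -/
theorem iteratedDeriv_log_hcizIntegral {N : ℕ} (A B : Matrix (Fin N) (Fin N) ℂ) {G : ℂ → ℂ} {r : ℝ}
    (hr : 0 < r) (hG : DifferentiableOn ℂ G (Metric.ball 0 r))
    (hfG : ∀ z ∈ Metric.ball 0 r, hcizIntegral A B z = Complex.exp (G z)) (n : ℕ) (hn : n + 1 < N) :
    iteratedDeriv (n + 1) G 0 = (-1) ^ (n + 1) * connectedFn A B (-(N : ℂ)⁻¹) (n + 1) := by
  induction n using Nat.strong_induction_on with
  | _ n ih =>
    have h1 := iteratedDeriv_succ_of_eq_exp hr hG hfG n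
    have hNpos : (0 : ℝ) < N := by exact_mod_cast (by omega : 0 < N)
    have h2 := partitionFn_succ A B (-(N : ℂ)⁻¹) n (by
      rw [norm_neg, norm_inv, Complex.norm_natCast, ← div_eq_mul_inv, div_lt_one hNpos]
      exact_mod_cast hn)
    rw [iteratedDeriv_hcizIntegral_zero A B _ hn, h2, Finset.sum_range_succ,
      Finset.sum_range_succ, mul_add, Finset.mul_sum] at h1
    have h3 : ∀ k ∈ Finset.range n, (-1 : ℂ) ^ (n + 1) * ((n.choose k : ℂ) *
        connectedFn A B (-(N : ℂ)⁻¹) (k + 1) * partitionFn A B (-(N : ℂ)⁻¹) (n - k)) =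
        (n.choose k : ℂ) * iteratedDeriv (k + 1) G 0 *
          iteratedDeriv (n - k) (hcizIntegral A B) 0 := by
      intro k hk
      have hk' := Finset.mem_range.mp hk
      rw [ih k hk' (by omega), iteratedDeriv_hcizIntegral_zero A B _ (by omega),
        show n + 1 = (k + 1) + (n - k) by omega, pow_add]
      ring
    rw [Finset.sum_congr rfl h3] at h1
    have h4 := add_left_cancel h1
    have h5 : partitionFn A B (-(N : ℂ)⁻¹) 0 = 1 := configSum_fin_zero A B _
    simp only [Nat.choose_self, Nat.cast_one, one_mul, Nat.sub_self, h5, mul_one,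
      iteratedDeriv_zero, hcizIntegral_zero] at h4
    exact h4.symm

/-- Uniformly bounded holomorphic functions on a disc whose Taylor coefficients at the centre
converge, converge uniformly on a smaller disc. -/
theorem tendstoUniformlyOn_of_tendsto_iteratedDeriv {F : ℕ → ℂ → ℂ} {a : ℕ → ℂ} {R C : ℝ}
    (hR : 0 < R)
    (hF : ∀ᶠ N in atTop, DifferentiableOn ℂ (F N) (Metric.ball 0 (2 * R)) ∧ F N 0 = 0 ∧
      ∀ z ∈ Metric.closedBall 0 R, ‖F N z‖ ≤ C)
    (ha : ∀ n, Tendsto (fun N => iteratedDeriv (n + 1) (F N) 0) atTop (𝓝 (a n))) :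
    (∀ z ∈ Metric.ball 0 (R / 2), Summable fun n => a n * z ^ (n + 1) / ((n + 1).factorial : ℂ)) ∧
    TendstoUniformlyOn F (fun z => ∑' n, a n * z ^ (n + 1) / ((n + 1).factorial : ℂ)) atTop
      (Metric.ball 0 (R / 2)) := by
  -- Cauchy's estimate on the circle of radius R, evaluated at radius R / 2, bounds the Taylor terms
  -- by C 2^(-n-1) uniformly in N; the limits inherit the bound.
  set c : ℕ → ℝ := fun n => (R / 2) ^ (n + 1) / ((n + 1).factorial : ℝ) with hc
  have hc0 : ∀ n, 0 ≤ c n := fun n => by positivity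
  have hbound : ∀ᶠ N in atTop, ∀ n, ‖iteratedDeriv (n + 1) (F N) 0‖ * c n ≤ C * (1 / 2) ^ (n + 1) := by
    filter_upwards [hF] with N hN n
    have hsub : Metric.closedBall (0 : ℂ) R ⊆ Metric.ball 0 (2 * R) :=
      Metric.closedBall_subset_ball (by linarith)
    have hd : DiffContOnCl ℂ (F N) (Metric.ball 0 R) := by
      refine DifferentiableOn.diffContOnCl ?_
      rw [closure_ball _ hR.ne']
      exact hN.1.mono hsub
    have h1 := Complex.norm_iteratedDeriv_le_of_forall_mem_sphere_norm_le (n + 1) hR hd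
      fun z hz => hN.2.2 z (Metric.sphere_subset_closedBall hz)
    calc _ ≤ ((n + 1).factorial * C / R ^ (n + 1)) * c n := by gcongr
      _ = _ := by
        simp only [hc, div_pow, one_pow]
        have := hR.ne'
        field_simp
  have hbound' : ∀ n, ‖a n‖ * c n ≤ C * (1 / 2) ^ (n + 1) := fun n =>
    le_of_tendsto ((ha n).norm.mul_const _) (hbound.mono fun N hN => hN n)
  have hgeo : Summable fun n : ℕ => C * (1 / 2 : ℝ) ^ (n + 1) :=
    ((summable_nat_add_iff 1).mpr summable_geometric_two).mul_left C
  have hz : ∀ z ∈ Metric.ball (0 : ℂ) (R / 2), ∀ (b : ℂ) n,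
      ‖b * z ^ (n + 1) / ((n + 1).factorial : ℂ)‖ ≤ ‖b‖ * c n := by
    intro z hz b n
    rw [norm_div, norm_mul, norm_pow, Complex.norm_natCast, mul_div_assoc]
    have : ‖z‖ ≤ R / 2 := (mem_ball_zero_iff.mp hz).le
    simp only [hc]
    gcongr
  have hsum : ∀ z ∈ Metric.ball (0 : ℂ) (R / 2),
      Summable fun n => a n * z ^ (n + 1) / ((n + 1).factorial : ℂ) := fun z hz' =>
    Summable.of_norm_bounded hgeo fun n => (hz z hz' _ n).trans (hbound' n)
  refine ⟨hsum, ?_⟩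
  -- This sum majorizes the distance between the two series at every z of the smaller disc, so its
  -- convergence to 0 gives uniformity.
  have hlim : Tendsto (fun N => ∑' n, ‖iteratedDeriv (n + 1) (F N) 0 - a n‖ * c n) atTop (𝓝 0) := by
    have h := tendsto_tsum_of_dominated_convergence (𝓕 := atTop)
      (f := fun N n => ‖iteratedDeriv (n + 1) (F N) 0 - a n‖ * c n) (g := fun _ => (0 : ℝ))
      (bound := fun n => 2 * (C * (1 / 2 : ℝ) ^ (n + 1))) (hgeo.mul_left 2) ?_ ?_
    · simpa using h
    · intro n
      have h1 := ((ha n).sub_const (a n)).norm.mul_const (c n)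
      simpa using h1
    · filter_upwards [hbound] with N hN n
      rw [norm_mul, norm_norm, Real.norm_of_nonneg (hc0 n)]
      calc _ ≤ (‖iteratedDeriv (n + 1) (F N) 0‖ + ‖a n‖) * c n := by
            gcongr
            exact norm_sub_le _ _
        _ ≤ _ := by
          have h1 := hN n
          have h2 := hbound' n
          linarith
  rw [Metric.tendstoUniformlyOn_iff]
  intro ε hε
  filter_upwards [hF, hbound, hlim.eventually (gt_mem_nhds hε)] with N hN hbN hlt z hzm
  have h1 := Complex.hasSum_taylorSeries_on_ball hN.1 (z := z) (by
    rw [mem_ball_zero_iff] at hzm ⊢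
    linarith)
  rw [← hasSum_nat_add_iff' 1] at h1
  simp only [sub_zero, smul_eq_mul, Finset.sum_range_one, iteratedDeriv_zero, hN.2.1, mul_zero] at h1
  have h2 := (hsum z hzm).hasSum.sub h1
  rw [dist_eq_norm, ← h2.tsum_eq]
  refine lt_of_le_of_lt ?_ hlt
  have hsd : Summable fun n => ‖iteratedDeriv (n + 1) (F N) 0 - a n‖ * c n := by
    refine Summable.of_nonneg_of_le (fun n => mul_nonneg (norm_nonneg _) (hc0 n)) (fun n => ?_)
      (hgeo.mul_left 2)
    calc _ ≤ (‖iteratedDeriv (n + 1) (F N) 0‖ + ‖a n‖) * c n := by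
          gcongr
          exact norm_sub_le _ _
      _ ≤ _ := by
        have h1 := hbN n
        have h2 := hbound' n
        linarith
  refine tsum_of_norm_bounded hsd.hasSum fun n => ?_
  have h3 : a n * z ^ (n + 1) / ((n + 1).factorial : ℂ) -
      ((n + 1).factorial : ℂ)⁻¹ * (z ^ (n + 1) * iteratedDeriv (n + 1) (F N) 0) =
      (a n - iteratedDeriv (n + 1) (F N) 0) * z ^ (n + 1) / ((n + 1).factorial : ℂ) := by
    ring
  rw [h3, norm_sub_rev]
  exact hz z hzm _ n

end FreeEnergy
-- Monotone walks correspond to the tuples counted by Hurwitz numbers.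
section Counting

set_option linter.unusedSectionVars false

variable {α : Type} [Fintype α] [LinearOrder α]

theorem swap_injective_of_lt {s t s' t' : α} (h : s < t) (h' : s' < t')
    (heq : swap s t = swap s' t') : s = s' ∧ t = t' := by
  have h1 : swap s' t' t = s := by rw [← heq, swap_apply_right]
  rcases eq_or_ne t t' with rfl | h2
  · rw [swap_apply_right] at h1
    exact ⟨h1.symm, rfl⟩
  · rcases eq_or_ne t s' with rfl | h3
    · rw [swap_apply_left] at h1
      exact absurd (h.trans h') (h1 ▸ lt_irrefl _)
    · rw [swap_apply_of_ne_of_ne h3 h2] at h1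
      exact absurd h1 h.ne'

theorem walkSteps_pairwise (L : α → List α) : (walkSteps L).Pairwise fun p q => p.2 ≤ q.2 := by
  unfold walkSteps
  rw [List.pairwise_flatMap]
  constructor
  · intro t _
    rw [List.pairwise_map]
    exact List.pairwise_of_forall (fun _ _ => le_rfl)
  · refine (Finset.sortedLT_sort _).pairwise.imp fun {a b} hab => ?_
    simp only [List.mem_map]
    rintro _ ⟨x, _, rfl⟩ _ ⟨y, _, rfl⟩
    exact hab.le

theorem filter_eq_append_filter_ne (t : α) (l : List (α × α))
    (hl : l.Pairwise fun p q => p.2 ≤ q.2) (ht : ∀ p ∈ l, t ≤ p.2) :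
    l.filter (fun p => p.2 = t) ++ l.filter (fun p => p.2 ≠ t) = l := by
  induction l with
  | nil => simp
  | cons p l ih =>
    rw [List.pairwise_cons] at hl
    by_cases h : p.2 = t
    · rw [List.filter_cons_of_pos (by simpa using h), List.filter_cons_of_neg (by simpa using h),
        List.cons_append, ih hl.2 fun q hq => ht q (List.mem_cons_of_mem _ hq)]
    · have h1 : ∀ q ∈ p :: l, q.2 ≠ t := by
        intro q hq
        have hp : t < p.2 := lt_of_le_of_ne (ht p List.mem_cons_self) (Ne.symm h)
        rcases List.mem_cons.mp hq with rfl | hq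
        · exact h
        · exact (hp.trans_le (hl.1 q hq)).ne'
      rw [List.filter_eq_nil_iff.mpr (by simpa using h1), List.filter_eq_self.mpr (by simpa using h1)]
      simp

theorem flatMap_filter_eq (ts : List α) (hts : ts.Pairwise (· < ·)) (l : List (α × α))
    (hl : l.Pairwise fun p q => p.2 ≤ q.2) (hmem : ∀ p ∈ l, p.2 ∈ ts) :
    ts.flatMap (fun t => l.filter fun p => p.2 = t) = l := by
  induction ts generalizing l with
  | nil =>
    cases l with
    | nil => rfl
    | cons p l => simpa using hmem p List.mem_cons_self
  | cons t ts ih =>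
    rw [List.pairwise_cons] at hts
    have h1 : ts.flatMap (fun t => l.filter fun p => p.2 = t) = l.filter (fun p => p.2 ≠ t) := by
      rw [← ih hts.2 (l.filter fun p => p.2 ≠ t) (hl.filter _)]
      · refine List.flatMap_congr fun t' ht' => ?_
        rw [List.filter_filter]
        refine List.filter_congr fun p _ => ?_
        have := (hts.1 t' ht').ne'
        by_cases hp : p.2 = t'
        · simp [hp, this]
        · simp [hp]
      · intro p hp
        rw [List.mem_filter] at hp
        have h2 := hmem p hp.1
        rw [List.mem_cons] at h2
        exact h2.resolve_left (by simpa using hp.2)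
    rw [List.flatMap_cons, h1]
    refine filter_eq_append_filter_ne t l hl fun p hp => ?_
    rcases List.mem_cons.mp (hmem p hp) with h | h
    · exact h.ge
    · exact (hts.1 _ h).le

/-- A list whose second entries are weakly increasing is the concatenation of its blocks of constant
second entry; the walk records the blocks. -/
theorem exists_walkSteps_eq (l : List (α × α)) (hl : l.Pairwise fun p q => p.2 ≤ q.2) :
    ∃ L : α → List α, walkSteps L = l := by
  refine ⟨fun t => (l.filter fun p => p.2 = t).map Prod.fst, ?_⟩
  unfold walkSteps
  conv_rhs => rw [← flatMap_filter_eq (Finset.univ.sort (α := α) (· ≤ ·))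
    (Finset.sortedLT_sort _).pairwise l hl (by simp)]
  refine List.flatMap_congr fun t _ => ?_
  rw [List.map_map]
  conv_rhs => rw [← List.map_id (l.filter fun p => p.2 = t)]
  refine List.map_congr_left fun p hp => ?_
  have := (List.mem_filter.mp hp).2
  simp only [decide_eq_true_eq] at this
  simp [← this]

theorem walk_eq_filter_walkSteps (L : α → List α) (t : α) :
    L t = ((walkSteps L).filter fun p => p.2 = t).map Prod.fst := by
  unfold walkSteps
  have key : ∀ ts : List α, ts.Nodup →
      ((ts.flatMap fun t => (L t).map fun s => (s, t)).filter fun p => p.2 = t).map Prod.fst =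
        if t ∈ ts then L t else [] := by
    intro ts hts
    induction ts with
    | nil => simp
    | cons t' ts ih =>
      rw [List.nodup_cons] at hts
      rw [List.flatMap_cons, List.filter_append, List.map_append, ih hts.2]
      by_cases h : t' = t
      · subst h
        simp [hts.1, List.filter_map, Function.comp_def]
      · simp [List.filter_map, Function.comp_def, h, Ne.symm h]
  rw [key _ (Finset.sort_nodup _ _)]
  simp

theorem walkSteps_injective : Function.Injective (walkSteps (α := α)) := by
  intro L L' h
  funext t
  rw [walk_eq_filter_walkSteps L, walk_eq_filter_walkSteps L', h]

theorem isPretransitive_iff_trans (T : Datum α) (gens : Set (Perm α))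
    (hg : ∀ g, g ∈ gens ↔ g = T.1 ∨ g = T.2.1 ∨ ∃ t, ∃ s ∈ T.2.2 t, g = swap s t) :
    MulAction.IsPretransitive (Subgroup.closure gens) α ↔ Trans T := by
  constructor
  · rintro ⟨h⟩ S hS ⟨a, ha⟩
    have key : ∀ g ∈ Subgroup.closure gens, ∀ x, g x ∈ S ↔ x ∈ S := by
      intro g hgc
      induction hgc using Subgroup.closure_induction with
      | mem g hgg =>
        intro x
        rcases (hg g).mp hgg with rfl | rfl | ⟨t, s, hs, rfl⟩
        · exact hS.1 x
        · exact hS.2.1 x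
        · have := hS.2.2 t s hs
          rcases eq_or_ne x s with rfl | h1
          · rw [swap_apply_left, this]
          · rcases eq_or_ne x t with rfl | h2
            · rw [swap_apply_right, this]
            · rw [swap_apply_of_ne_of_ne h1 h2]
      | one => simp
      | mul g h _ _ hg' hh' => intro x; rw [Perm.mul_apply, hg', hh']
      | inv g _ hg' =>
        intro x
        rw [← hg' (g⁻¹ x)]
        simp
    refine Set.eq_univ_of_forall fun b => ?_
    obtain ⟨g, rfl⟩ := h a b
    exact (key g g.2 a).mpr ha
  · intro h
    refine ⟨fun x z => ?_⟩
    let S : Set α := {z | ∃ g ∈ Subgroup.closure gens, g x = z}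
    have hstep : ∀ g ∈ Subgroup.closure gens, ∀ a, g a ∈ S ↔ a ∈ S := by
      intro g hgc a
      constructor
      · rintro ⟨k, hk, hka⟩
        refine ⟨g⁻¹ * k, Subgroup.mul_mem _ (Subgroup.inv_mem _ hgc) hk, ?_⟩
        rw [Perm.mul_apply, hka]
        simp
      · rintro ⟨k, hk, rfl⟩
        exact ⟨g * k, Subgroup.mul_mem _ hgc hk, rfl⟩
    have hin : ∀ g, (g = T.1 ∨ g = T.2.1 ∨ ∃ t, ∃ s ∈ T.2.2 t, g = swap s t) →
        g ∈ Subgroup.closure gens := fun g h' => Subgroup.subset_closure ((hg g).mpr h')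
    have hS : Inv T S := by
      refine ⟨hstep _ (hin _ (Or.inl rfl)), hstep _ (hin _ (Or.inr (Or.inl rfl))),
        fun t s hs => ?_⟩
      have := hstep _ (hin (swap s t) (Or.inr (Or.inr ⟨t, s, hs, rfl⟩))) t
      rwa [swap_apply_right] at this
    have hu := h S hS ⟨x, 1, Subgroup.one_mem _, rfl⟩
    obtain ⟨g, hgc, hgx⟩ : z ∈ S := hu ▸ Set.mem_univ z
    exact ⟨⟨g, hgc⟩, hgx⟩

/-- The sequence of transpositions of a walk. -/
def walkTuple {r : ℕ} (L : α → List α) (h : walkLength L = r) (i : Fin r) : Perm α :=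
  swap ((walkSteps L)[i]'(by rw [length_walkSteps, h]; exact i.2)).1
    ((walkSteps L)[i]'(by rw [length_walkSteps, h]; exact i.2)).2

theorem ofFn_walkTuple {r : ℕ} (L : α → List α) (h : walkLength L = r) :
    List.ofFn (walkTuple L h) = (walkSteps L).map fun p => swap p.1 p.2 := by
  refine List.ext_getElem (by simp [length_walkSteps, h]) fun i h1 h2 => ?_
  simp [walkTuple]

theorem mem_range_walkTuple {r : ℕ} (L : α → List α) (h : walkLength L = r) (g : Perm α) :
    g ∈ Set.range (walkTuple L h) ↔ ∃ t, ∃ s ∈ L t, g = swap s t := by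
  rw [← Set.mem_ofPred_eq (p := fun g => g ∈ Set.range (walkTuple L h)), Set.mem_ofPred_eq,
    ← List.mem_ofFn', ofFn_walkTuple, List.mem_map]
  constructor
  · rintro ⟨p, hp, rfl⟩
    exact ⟨p.2, p.1, mem_walkSteps.mp hp, rfl⟩
  · rintro ⟨t, s, hs, rfl⟩
    exact ⟨(s, t), mem_walkSteps.mpr hs, rfl⟩

theorem walkTuple_monotone {r : ℕ} (L : α → List α) (hL : ValidWalk L) (h : walkLength L = r) :
    ∃ s t : Fin r → α, (∀ i, s i < t i ∧ walkTuple L h i = swap (s i) (t i)) ∧ Monotone t := by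
  have hlen : ∀ i : Fin r, (i : ℕ) < (walkSteps L).length := fun i => by
    rw [length_walkSteps, h]; exact i.2
  refine ⟨fun i => ((walkSteps L)[i]'(hlen i)).1, fun i => ((walkSteps L)[i]'(hlen i)).2,
    fun i => ⟨?_, rfl⟩, ?_⟩
  · exact hL _ _ (mem_walkSteps.mp (List.getElem_mem (hlen i)))
  · intro i j hij
    rcases eq_or_lt_of_le hij with rfl | hlt
    · exact le_rfl
    · exact List.pairwise_iff_getElem.mp (walkSteps_pairwise L) i j (hlen i) (hlen j) hlt

theorem exists_walkTuple {r : ℕ} (τ : Fin r → Perm α) (s t : Fin r → α)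
    (hst : ∀ i, s i < t i ∧ τ i = swap (s i) (t i)) (ht : Monotone t) :
    ∃ (L : α → List α) (h : walkLength L = r), ValidWalk L ∧ walkTuple L h = τ := by
  have hp : (List.ofFn fun i => (s i, t i)).Pairwise fun p q => p.2 ≤ q.2 := by
    rw [List.pairwise_ofFn]
    exact fun i j hij => ht hij.le
  obtain ⟨L, hL⟩ := exists_walkSteps_eq _ hp
  have hlen : walkLength L = r := by rw [← length_walkSteps, hL, List.length_ofFn]
  refine ⟨L, hlen, fun t' s' hs => ?_, ?_⟩
  · have h1 := mem_walkSteps (p := (s', t')).mpr hs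
    rw [hL, List.mem_ofFn'] at h1
    obtain ⟨i, hi⟩ := h1
    simp only [Prod.mk.injEq] at hi
    rw [← hi.1, ← hi.2]
    exact (hst i).1
  · have h1 := ofFn_walkTuple L hlen
    rw [hL] at h1
    refine List.ofFn_injective (h1.trans ?_)
    rw [List.map_ofFn]
    congr 1
    funext i
    exact ((hst i).2).symm

theorem walkTuple_injective {r : ℕ} {L L' : α → List α} (hL : ValidWalk L) (hL' : ValidWalk L')
    (h : walkLength L = r) (h' : walkLength L' = r) (heq : walkTuple L h = walkTuple L' h') :
    L = L' := by
  apply walkSteps_injective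
  refine List.ext_getElem (by rw [length_walkSteps, length_walkSteps, h, h']) fun i h1 h2 => ?_
  have hi : i < r := by rwa [length_walkSteps, h] at h1
  have h3 := swap_injective_of_lt (hL _ _ (mem_walkSteps.mp (List.getElem_mem h1)))
    (hL' _ _ (mem_walkSteps.mp (List.getElem_mem h2))) (congrFun heq ⟨i, hi⟩)
  exact Prod.ext h3.1 h3.2

/-- A transposition determines its pair s < t, and a monotone sequence its grouping by t, so tuples
and walks of length r are in bijection. Products and transitivity agree on both sides. -/
theorem monotoneCount_eq {d : ℕ} (r : ℕ) (a b : Nat.Partition d) :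
    monotoneCount r a b = Nat.card {T : Datum (Fin d) // T.1.partition.parts = a.parts ∧
      T.2.1.partition.parts = b.parts ∧ IsConfig T ∧ Trans T ∧ walkLength T.2.2 = r} := by
  unfold monotoneCount
  symm
  have hprod : ∀ (T : Datum (Fin d)) (h : walkLength T.2.2 = r),
      (List.ofFn (walkTuple T.2.2 h)).prod = walkPerm T.2.2 := by
    intro T h
    rw [ofFn_walkTuple, walkPerm_eq_prod]
  have htr : ∀ (T : Datum (Fin d)) (h : walkLength T.2.2 = r), MulAction.IsPretransitive
      (Subgroup.closure ({T.1, T.2.1} ∪ Set.range (walkTuple T.2.2 h))) (Fin d) ↔ Trans T := by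
    intro T h
    refine isPretransitive_iff_trans T _ fun g => ?_
    rw [Set.mem_union, mem_range_walkTuple, Set.mem_insert_iff, Set.mem_singleton_iff, or_assoc]
  refine Nat.card_congr (Equiv.ofBijective (fun T =>
    ⟨(T.1.1, T.1.2.1, walkTuple T.1.2.2 T.2.2.2.2.2), T.2.1, T.2.2.1, ?_, ?_, ?_⟩) ⟨?_, ?_⟩)
  · simp only [hprod]
    exact T.2.2.2.1.2
  · exact (htr T.1 T.2.2.2.2.2).mpr T.2.2.2.2.1
  · exact walkTuple_monotone _ T.2.2.2.1.1 T.2.2.2.2.2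
  · rintro ⟨⟨ρ, σ, L⟩, h⟩ ⟨⟨ρ', σ', L'⟩, h'⟩ heq
    simp only [Subtype.mk.injEq, Prod.mk.injEq] at heq
    obtain ⟨rfl, rfl, h3⟩ := heq
    have := walkTuple_injective h.2.2.1.1 h'.2.2.1.1 _ _ h3
    subst this
    rfl
  · rintro ⟨⟨ρ, σ, τ⟩, h1, h2, h3, h4, s, t, hst, ht⟩
    obtain ⟨L, hL, hval, rfl⟩ := exists_walkTuple τ s t hst ht
    refine ⟨⟨(ρ, σ, L), h1, h2, ⟨hval, ?_⟩, (htr (ρ, σ, L) hL).mp h4, hL⟩, rfl⟩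
    rw [← hprod (ρ, σ, L) hL]
    exact h3

end Counting
-- The large N limit of the connected sums.
section Limit

/-- The product of the normalized traces of the powers of `A` over the cycles of `ρ`. -/
def normTrace {d N : ℕ} (A : Matrix (Fin N) (Fin N) ℂ) (ρ : Perm (Fin d)) : ℂ :=
  (ρ.partition.parts.map fun k => (N : ℂ)⁻¹ * Matrix.trace (A ^ k)).prod

theorem cycTrace_eq_pow_mul_normTrace {d N : ℕ} (hN : N ≠ 0) (A : Matrix (Fin N) (Fin N) ℂ)
    (ρ : Perm (Fin d)) :
    cycTrace A ρ = (N : ℂ) ^ Multiset.card ρ.partition.parts * normTrace A ρ := by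
  rw [cycTrace_eq_prod, normTrace, Multiset.prod_map_mul, Multiset.map_const', Multiset.prod_replicate,
    ← mul_assoc, ← mul_pow, mul_inv_cancel₀ (Nat.cast_ne_zero.mpr hN), one_pow, one_mul]

theorem tendsto_normTrace {d : ℕ} {A : (N : ℕ) → Matrix (Fin N) (Fin N) ℂ} {φ : ℕ → ℂ}
    (hA : ∀ k ≥ 1, Tendsto (fun N : ℕ => (N : ℂ)⁻¹ * Matrix.trace (A N ^ k)) atTop (𝓝 (φ k)))
    (ρ : Perm (Fin d)) :
    Tendsto (fun N => normTrace (A N) ρ) atTop (𝓝 (ρ.partition.parts.map φ).prod) :=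
  tendsto_multiset_prod _ fun k hk => hA k (ρ.partition.parts_pos hk)

theorem card_parts_le {d : ℕ} (ρ : Perm (Fin d)) : Multiset.card ρ.partition.parts ≤ d := by
  have h1 := finrank_range_permRep ρ
  have h2 := Fintype.card_fin d
  omega

/-- A planar configuration: a transitive configuration whose number of steps is minimal. -/
def IsPlanar {d : ℕ} (T : Datum (Fin d)) : Prop :=
  IsConfig T ∧ Trans T ∧
    Multiset.card T.1.partition.parts + Multiset.card T.2.1.partition.parts = walkLength T.2.2 + 2

/-- Planarity fixes the walk length in terms of cycle counts that are at most d, so all lists have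
length at most 2d. -/
theorem finite_isPlanar (d : ℕ) : {T : Datum (Fin d) | IsPlanar T}.Finite := by
  have h1 : {L : Fin d → List (Fin d) | ∀ t, L t ∈ {l | l.length ≤ 2 * d}}.Finite :=
    Set.Finite.pi' fun _ => List.finite_length_le _ _
  refine ((Set.finite_univ (α := Perm (Fin d))).prod
    ((Set.finite_univ (α := Perm (Fin d))).prod h1)).subset ?_
  rintro T ⟨-, -, h⟩
  refine ⟨Set.mem_univ _, Set.mem_univ _, fun t => ?_⟩
  have h2 : (T.2.2 t).length ≤ walkLength T.2.2 :=
    Finset.single_le_sum (f := fun t => (T.2.2 t).length) (fun _ _ => Nat.zero_le _)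
      (Finset.mem_univ t)
  have h3 := card_parts_le T.1
  have h4 := card_parts_le T.2.1
  rw [Set.mem_ofPred_eq]
  omega

/-- The cycle type of a permutation, as a partition of `d`. -/
def cyclePartition {d : ℕ} (ρ : Perm (Fin d)) : Nat.Partition d :=
  ⟨ρ.partition.parts, ρ.partition.parts_pos, by simpa using ρ.partition.parts_sum⟩

open Classical in
/-- The limit of the normalized weights. -/
def planarWeight {d : ℕ} (φ ψ : ℕ → ℂ) (T : Datum (Fin d)) : ℂ :=
  if IsPlanar T then (-1) ^ (d + walkLength T.2.2) * (T.1.partition.parts.map φ).prod *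
    (T.2.1.partition.parts.map ψ).prod else 0

theorem len_pos {d : ℕ} (hd : d ≠ 0) (a : Nat.Partition d) : 1 ≤ len a := by
  rw [len, Nat.one_le_iff_ne_zero, Ne, Multiset.card_eq_zero]
  intro h
  have := a.parts_sum
  rw [h, Multiset.sum_zero] at this
  exact hd this.symm

/-- Group planar configurations by their pair of cycle types; r = ℓ(α) + ℓ(β) - 2 reconciles the
signs. As d ≠ 0, both lengths are positive and the truncated subtraction defining r is a true one.
-/
theorem tsum_planarWeight {d : ℕ} (hd : d ≠ 0) (φ ψ : ℕ → ℂ) :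
    ∑' T : Datum (Fin d), planarWeight φ ψ T = coeffC 0 d φ ψ := by
  classical
  have hsupp : ∀ T ∉ (finite_isPlanar d).toFinset, planarWeight φ ψ T = 0 := fun T hT =>
    if_neg (by simpa using hT)
  rw [tsum_eq_sum hsupp, coeffC, ← Fintype.sum_prod_type',
    ← Finset.sum_fiberwise _ fun T => (cyclePartition T.1, cyclePartition T.2.1)]
  refine Finset.sum_congr rfl fun p _ => ?_
  obtain ⟨a, b⟩ := p
  have ha := len_pos hd a
  have hb := len_pos hd b
  have hval : ∀ T ∈ (finite_isPlanar d).toFinset.filter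
      (fun T => (cyclePartition T.1, cyclePartition T.2.1) = (a, b)),
      planarWeight φ ψ T = (-1) ^ (d + len a + len b) * partProd φ a * partProd ψ b := by
    intro T hT
    rw [Finset.mem_filter, Set.Finite.mem_toFinset, Set.mem_ofPred_eq, Prod.mk.injEq] at hT
    obtain ⟨hp, rfl, rfl⟩ := hT
    rw [planarWeight, if_pos hp]
    have h1 : d + len (cyclePartition T.1) + len (cyclePartition T.2.1) =
        d + walkLength T.2.2 + 2 := by
      have := hp.2.2
      simp only [len, cyclePartition]
      omega
    rw [h1, pow_add _ _ 2, neg_one_sq, mul_one]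
    rfl
  rw [Finset.sum_congr rfl hval, Finset.sum_const, nsmul_eq_mul, monotoneHurwitz, monotoneCount_eq,
    Nat.subtype_card ((finite_isPlanar d).toFinset.filter
      (fun T => (cyclePartition T.1, cyclePartition T.2.1) = (a, b)))]
  · ring
  · intro T
    rw [Finset.mem_filter, Set.Finite.mem_toFinset, Set.mem_ofPred_eq, Prod.mk.injEq,
      Nat.Partition.ext_iff, Nat.Partition.ext_iff, IsPlanar]
    simp only [cyclePartition, len] at *
    constructor
    · rintro ⟨⟨h1, h2, h3⟩, h4, h5⟩
      rw [h4, h5] at h3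
      exact ⟨h4, h5, h1, h2, by omega⟩
    · rintro ⟨h4, h5, h1, h2, h3⟩
      refine ⟨⟨h1, h2, ?_⟩, h4, h5⟩
      rw [h4, h5]
      omega

/-- Counts powers of N. The excess `e` plays the role of twice the genus; its parity is never
needed. -/
theorem normalized_weight {d N : ℕ} (hN : N ≠ 0) (A B : Matrix (Fin N) (Fin N) ℂ)
    (T : Datum (Fin d)) (e : ℕ) (he : Multiset.card T.1.partition.parts +
      Multiset.card T.2.1.partition.parts + e = walkLength T.2.2 + 2) :
    ((N : ℂ) ^ 2)⁻¹ * ((-1) ^ d * weight A B (-(N : ℂ)⁻¹) T) =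
      (-1) ^ (d + walkLength T.2.2) * normTrace A T.1 * normTrace B T.2.1 * ((N : ℂ)⁻¹) ^ e := by
  have hN' : (N : ℂ) ≠ 0 := Nat.cast_ne_zero.mpr hN
  rw [weight, cycTrace_eq_pow_mul_normTrace hN, cycTrace_eq_pow_mul_normTrace hN, neg_pow, pow_add]
  have h1 : ((N : ℂ) ^ 2)⁻¹ * ((N : ℂ) ^ Multiset.card T.1.partition.parts *
      (N : ℂ) ^ Multiset.card T.2.1.partition.parts * ((N : ℂ)⁻¹) ^ walkLength T.2.2) =
      ((N : ℂ)⁻¹) ^ e := by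
    rw [inv_pow, inv_pow]
    field_simp
    rw [← pow_add, ← pow_add, ← pow_add, he, add_comm]
  rw [← h1]
  ring

theorem tendsto_connectedFn {d : ℕ} (hd : d ≠ 0) {A B : (N : ℕ) → Matrix (Fin N) (Fin N) ℂ}
    {φ ψ : ℕ → ℂ}
    (hA : ∀ k ≥ 1, Tendsto (fun N : ℕ => (N : ℂ)⁻¹ * Matrix.trace (A N ^ k)) atTop (𝓝 (φ k)))
    (hB : ∀ k ≥ 1, Tendsto (fun N : ℕ => (N : ℂ)⁻¹ * Matrix.trace (B N ^ k)) atTop (𝓝 (ψ k))) :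
    Tendsto (fun N : ℕ => ((N : ℂ) ^ 2)⁻¹ *
      ((-1) ^ d * connectedFn (A N) (B N) (-(N : ℂ)⁻¹) d)) atTop (𝓝 (coeffC 0 d φ ψ)) := by
  classical
  have hbound : ∀ {A : (N : ℕ) → Matrix (Fin N) (Fin N) ℂ} {φ : ℕ → ℂ},
      (∀ k ≥ 1, Tendsto (fun N : ℕ => (N : ℂ)⁻¹ * Matrix.trace (A N ^ k)) atTop (𝓝 (φ k))) →
      ∃ C : ℝ, 0 ≤ C ∧ ∀ᶠ N in atTop, ∀ ρ : Perm (Fin d), ‖normTrace (A N) ρ‖ ≤ C := by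
    intro A φ hA
    have h1 : Tendsto (fun N => fun ρ : Perm (Fin d) => normTrace (A N) ρ) atTop
        (𝓝 fun ρ => (ρ.partition.parts.map φ).prod) :=
      tendsto_pi_nhds.mpr fun ρ => tendsto_normTrace hA ρ
    refine ⟨‖fun ρ : Perm (Fin d) => (ρ.partition.parts.map φ).prod‖ + 1, by positivity, ?_⟩
    filter_upwards [h1.norm.eventually (eventually_le_nhds (lt_add_one _))] with N hN ρ
    exact (norm_le_pi_norm (fun ρ : Perm (Fin d) => normTrace (A N) ρ) ρ).trans hN
  obtain ⟨a, ha0, ha⟩ := hbound hA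
  obtain ⟨b, hb0, hb⟩ := hbound hB
  rw [← tsum_planarWeight hd φ ψ]
  have hc0 : (0 : ℝ) < ((d + 1 : ℕ) : ℝ) := by positivity
  -- For N ≥ c = d + 1 and a walk of length r, the excess satisfies e ≥ r - 2d, so N^(-e) ≤ c^(2d)
  -- c^(-r). This is summable over walks because d / (d + 1) < 1, and it does not depend on N.
  set c : ℝ := ((d + 1 : ℕ) : ℝ) with hc
  have hsum : Summable fun T : Datum (Fin d) => a * b * c ^ (2 * d) * (c⁻¹) ^ walkLength T.2.2 := by
    have h3 := summable_pow_walkLength (α := Fin d) c⁻¹ (by positivity) (by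
      rw [Fintype.card_fin, ← div_eq_mul_inv, div_lt_one hc0, hc]
      exact_mod_cast Nat.lt_succ_self d)
    have h1 : Summable fun ρ : Perm (Fin d) => (1 : ℝ) := Summable.of_finite
    have := h1.mul_of_nonneg (h1.mul_of_nonneg h3 (fun _ => zero_le_one)
      (fun L => by simp only [Pi.zero_apply]; positivity)) (fun _ => zero_le_one)
      (fun L => by simp only [Pi.zero_apply]; positivity)
    refine (this.mul_left (a * b * c ^ (2 * d))).congr fun T => ?_
    simp
  have hgenus : ∀ T : Datum (Fin d), IsConfig T → Trans T → ∃ e,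
      Multiset.card T.1.partition.parts + Multiset.card T.2.1.partition.parts + e =
        walkLength T.2.2 + 2 := fun T h1 h2 =>
    (Nat.exists_eq_add_of_le (card_parts_add_card_parts_le T h1 h2)).imp fun _ h => h.symm
  refine (tendsto_tsum_of_dominated_convergence hsum (f := fun (N : ℕ) T => ((N : ℂ) ^ 2)⁻¹ *
    ((-1) ^ d * ({T | IsConfig T} ∩ {T | Trans T}).indicator
      (weight (A N) (B N) (-(N : ℂ)⁻¹)) T)) (fun T => ?_) ?_).congr fun N => ?_
  · by_cases hT : T ∈ {T | IsConfig T} ∩ {T | Trans T}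
    · obtain ⟨e, he⟩ := hgenus T hT.1 hT.2
      have hlim : Tendsto (fun N : ℕ => ((N : ℂ)⁻¹) ^ e) atTop (𝓝 (if e = 0 then 1 else 0)) := by
        have := (tendsto_inv_atTop_nhds_zero_nat (𝕜 := ℂ)).pow e
        rwa [zero_pow_eq] at this
      have h1 := (((tendsto_normTrace hA T.1).const_mul ((-1 : ℂ) ^ (d + walkLength T.2.2))).mul
        (tendsto_normTrace hB T.2.1)).mul hlim
      have h2 : planarWeight φ ψ T = (-1 : ℂ) ^ (d + walkLength T.2.2) *
          (T.1.partition.parts.map φ).prod * (T.2.1.partition.parts.map ψ).prod *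
          (if e = 0 then 1 else 0) := by
        have h3 : IsPlanar T ↔ e = 0 := by
          rw [IsPlanar]
          exact ⟨fun h => by have := h.2.2; omega, fun h => ⟨hT.1, hT.2, by omega⟩⟩
        simp only [planarWeight, h3]
        split_ifs <;> simp
      rw [h2]
      refine h1.congr' ?_
      filter_upwards [eventually_ge_atTop 1] with N hN
      rw [Set.indicator_of_mem hT, normalized_weight (by omega) _ _ T e he]
    · have h2 : planarWeight φ ψ T = 0 := if_neg fun h => hT ⟨h.1, h.2.1⟩
      rw [h2]
      refine tendsto_const_nhds.congr fun N => ?_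
      rw [Set.indicator_of_notMem hT, mul_zero, mul_zero]
  · filter_upwards [ha, hb, eventually_ge_atTop (d + 1)] with N haN hbN hN T
    by_cases hT : T ∈ {T | IsConfig T} ∩ {T | Trans T}
    · obtain ⟨e, he⟩ := hgenus T hT.1 hT.2
      rw [Set.indicator_of_mem hT, normalized_weight (by omega) _ _ T e he]
      have hle : ((N : ℝ)⁻¹) ^ e ≤ c ^ (2 * d) * (c⁻¹) ^ walkLength T.2.2 := by
        have hcN : c ≤ N := by rw [hc]; exact_mod_cast hN
        have h1c : 1 ≤ c := by rw [hc]; exact_mod_cast Nat.succ_pos d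
        have h3 := card_parts_le T.1
        have h4 := card_parts_le T.2.1
        calc ((N : ℝ)⁻¹) ^ e ≤ (c⁻¹) ^ e := by gcongr
          _ ≤ c ^ (2 * d) * (c⁻¹) ^ walkLength T.2.2 := by
            rw [inv_pow, inv_pow, ← div_eq_mul_inv, le_div_iff₀ (by positivity),
              inv_mul_le_iff₀ (by positivity), ← pow_add]
            exact pow_le_pow_right₀ h1c (by omega)
      rw [norm_mul, norm_mul, norm_mul, norm_pow, norm_pow, norm_neg, norm_one, one_pow, one_mul,
        norm_inv, Complex.norm_natCast, mul_assoc (a * b)]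
      exact mul_le_mul (mul_le_mul (haN _) (hbN _) (norm_nonneg _) ha0) hle (by positivity)
        (by positivity)
    · rw [Set.indicator_of_notMem hT, mul_zero, mul_zero, norm_zero]
      positivity
  · rw [tsum_mul_left, tsum_mul_left]
    rfl

end Limit
-- Use of the hypotheses and the main theorem.
theorem IsRegular.tendsto_moments {M : ℝ} {A : (N : ℕ) → Matrix (Fin N) (Fin N) ℂ} {φ : ℕ → ℂ}
    (hA : IsRegular M 0 A φ) (k : ℕ) (hk : 1 ≤ k) :
    Tendsto (fun N : ℕ => (N : ℂ)⁻¹ * Matrix.trace (A N ^ k)) atTop (𝓝 (φ k)) := by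
  have h := hA.moments k hk
  simp only [mul_zero, pow_zero, inv_one] at h
  exact tendsto_sub_nhds_zero_iff.mp ((Asymptotics.isLittleO_one_iff ℝ).mp h)

theorem NonVanishing.exists_ball {A B : (N : ℕ) → Matrix (Fin N) (Fin N) ℂ}
    (h : NonVanishing A B) :
    ∃ r > 0, ∀ N ≥ 1, ∀ z ∈ Metric.ball (0 : ℂ) r, hcizIntegral (A N) (B N) z ≠ 0 := by
  obtain ⟨r, hr, hsub⟩ := Metric.mem_nhds_iff.mp (isClosed_closure.isOpen_compl.mem_nhds h)
  refine ⟨r, hr, fun N hN z hz h0 => hsub hz (subset_closure ?_)⟩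
  simp only [Set.mem_iUnion]
  exact ⟨N, hN, h0⟩

end HCIZ
end

theorem theorem4 (M : ℝ) (hM : 0 ≤ M)
    (A B : (N : ℕ) → Matrix (Fin N) (Fin N) ℂ) (φ ψ : ℕ → ℂ)
    (hA : HCIZ.IsRegular M 0 A φ) (hB : HCIZ.IsRegular M 0 B ψ)
    (hAB : HCIZ.NonVanishing A B) :
    ∃ D : Set ℂ, IsOpen D ∧ IsSimplyConnected D ∧ (0 : ℂ) ∈ D ∧
      (∀ z ∈ D, M ^ 2 * ‖z‖ < 2 / 27) ∧
      (∀ N ≥ 1, ∀ z ∈ D, HCIZ.hcizIntegral (A N) (B N) z ≠ 0) ∧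
      (∀ z ∈ D, Summable (HCIZ.termC 0 φ ψ z)) ∧
      ∃ F : ℕ → ℂ → ℂ,
        (∀ N ≥ 1, HCIZ.IsFreeEnergyOn (A N) (B N) D (F N)) ∧
        ∀ K ⊆ D, IsCompact K → TendstoUniformlyOn F (HCIZ.genC 0 φ ψ) atTop K := by
  obtain ⟨r, hr, hne⟩ := hAB.exists_ball
  -- Three concentric discs: logarithms live on radius 2R, Borel–Carathéodory bounds them on radius
  -- R, and convergence holds on D of radius R / 2. Adding 1 to M² covers M = 0.
  obtain ⟨R, hR, hRr, hRM⟩ : ∃ R > 0, 2 * R ≤ r ∧ M ^ 2 * R < 2 / 27 := by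
    refine ⟨min (r / 2) (1 / 27 / (M ^ 2 + 1)), by positivity, ?_, ?_⟩
    · have := min_le_left (r / 2) (1 / 27 / (M ^ 2 + 1))
      linarith
    · calc M ^ 2 * min (r / 2) (1 / 27 / (M ^ 2 + 1))
          ≤ (M ^ 2 + 1) * (1 / 27 / (M ^ 2 + 1)) := by
            gcongr
            · linarith
            · exact min_le_right _ _
        _ = 1 / 27 := by field_simp
        _ < 2 / 27 := by norm_num
  have hsub : Metric.ball (0 : ℂ) (R / 2) ⊆ Metric.ball 0 (2 * R) :=
    Metric.ball_subset_ball (by linarith)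
  have hlog : ∀ N : ℕ, ∃ G : ℂ → ℂ, 1 ≤ N → DifferentiableOn ℂ G (Metric.ball 0 (2 * R)) ∧
      G 0 = 0 ∧ ∀ z ∈ Metric.ball 0 (2 * R),
        HCIZ.hcizIntegral (A N) (B N) z = Complex.exp (G z) := by
    intro N
    by_cases hN : 1 ≤ N
    · obtain ⟨G, hG⟩ := HCIZ.exists_log_on_ball (f := HCIZ.hcizIntegral (A N) (B N))
        (r := 2 * R) (by positivity) (HCIZ.differentiable_hcizIntegral _ _).differentiableOn
        (HCIZ.hcizIntegral_zero _ _) fun z hz => hne N hN z (Metric.ball_subset_ball hRr hz)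
      exact ⟨G, fun _ => hG⟩
    · exact ⟨0, fun h => absurd h hN⟩
  choose G hG using hlog
  set F : ℕ → ℂ → ℂ := fun N z => ((N : ℂ) ^ 2)⁻¹ * G N z with hF
  have hFG : ∀ N : ℕ, N ≥ 1 → ∀ z, (N : ℂ) ^ 2 * F N z = G N z := fun N hN z => by
    have : (N : ℂ) ≠ 0 := Nat.cast_ne_zero.mpr (by omega)
    rw [hF]
    field_simp
  have hFd : ∀ N ≥ 1, DifferentiableOn ℂ (F N) (Metric.ball 0 (2 * R)) := fun N hN =>
    (hG N hN).1.const_mul _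
  have hF0 : ∀ N ≥ 1, F N 0 = 0 := fun N hN => by
    simp only [hF, (hG N hN).2.1, mul_zero]
  have hFre : ∀ N ≥ 1, ∀ z ∈ Metric.ball (0 : ℂ) (2 * R), (F N z).re ≤ 1 := by
    intro N hN z hz
    have h1 := HCIZ.norm_hcizIntegral_le (A N) (B N) M hM (hA.norm_le N hN) (hB.norm_le N hN) z
    have h2 : (0 : ℝ) < (N : ℝ) ^ 2 := by
      have : (0 : ℝ) < N := by exact_mod_cast hN
      positivity
    have h3 : ((N : ℂ) ^ 2 * F N z).re = (N : ℝ) ^ 2 * (F N z).re := by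
      rw [← Complex.ofReal_natCast, ← Complex.ofReal_pow, Complex.re_ofReal_mul]
    rw [(hG N hN).2.2 z hz, Complex.norm_exp, ← hFG N hN, h3, Real.exp_le_exp,
      mul_le_mul_iff_right₀ h2] at h1
    rw [mem_ball_zero_iff] at hz
    calc (F N z).re ≤ M ^ 2 * ‖z‖ := h1
      _ ≤ M ^ 2 * (2 * R) := by gcongr
      _ ≤ 1 := by linarith
  -- From Re F_N ≤ 1 on radius 2R and F_N(0) = 0, the bound at |z| ≤ R is 2|z| / (2R - |z|) ≤ 2.
  have hFle : ∀ N ≥ 1, ∀ z ∈ Metric.closedBall (0 : ℂ) R, ‖F N z‖ ≤ 2 := by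
    intro N hN z hz
    rw [mem_closedBall_zero_iff] at hz
    refine (Complex.borelCaratheodory_zero one_pos (hFd N hN) (fun w hw => hFre N hN w hw)
      (by positivity) (by rw [mem_ball_zero_iff]; linarith) (hF0 N hN)).trans ?_
    rw [div_le_iff₀ (by linarith)]
    linarith
  have hcoef : ∀ n, Tendsto (fun N => iteratedDeriv (n + 1) (F N) 0) atTop
      (𝓝 (HCIZ.coeffC 0 (n + 1) φ ψ)) := by
    intro n
    refine (HCIZ.tendsto_connectedFn n.succ_ne_zero hA.tendsto_moments hB.tendsto_moments).congr' ?_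
    filter_upwards [eventually_gt_atTop (n + 1)] with N hN
    have hGN := hG N (by omega)
    rw [hF, iteratedDeriv_const_mul_field,
      HCIZ.iteratedDeriv_log_hcizIntegral (A N) (B N) (by positivity) hGN.1 hGN.2.2 n hN]
  obtain ⟨hsum, hunif⟩ := HCIZ.tendstoUniformlyOn_of_tendsto_iteratedDeriv (C := 2) hR
    (by filter_upwards [eventually_ge_atTop 1] with N hN using ⟨hFd N hN, hF0 N hN, hFle N hN⟩)
    hcoef
  refine ⟨Metric.ball 0 (R / 2), Metric.isOpen_ball, ?_, Metric.mem_ball_self (by positivity),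
    fun z hz => ?_, fun N hN z hz => hne N hN z (Metric.ball_subset_ball hRr (hsub hz)), hsum, F,
    fun N hN => ⟨(hFd N hN).mono hsub, hF0 N hN, fun z hz => ?_⟩, fun K hK _ => hunif.mono hK⟩
  · have := Metric.contractibleSpace_ball (x := (0 : ℂ)) (r := R / 2) (by positivity)
    exact SimplyConnectedSpace.ofContractible _
  · rw [mem_ball_zero_iff] at hz
    refine lt_of_le_of_lt ?_ hRM
    gcongr
    linarith
  · rw [hFG N hN, (hG N hN).2.2 z (hsub hz)]
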